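/- **Notation.** Let $\Lambda=\mathbb C[p_1,p_2,\dots]$ be the algebra of symmetric functions, put $$H(u)=1+\sum_{k\ge1}\frac{h_k}{u^k}=\exp\Bigl(\sum_{k\ge1}\frac{p_k}{k\,u^k}\Bigr),\qquad E(u)=1+\sum_{k\ge1}\frac{e_k}{u^k}=H(-u)^{-1}$$ (formal series in $u^{-1}$), and let $\omega:\Lambda\to\Lambda$ be the algebra isomorphism with $\omega(p_k)=(-1)^{k-1}p_k$. For a sequence $a=(a_i)_{i\in\mathbb Z}$ of complex numbers put $(\tau^ra)_i=a_{i+r}$ and $\hat a_i=-a_{1-i}$. Define $h_{k;a}\in\Lambda$ by $$1+\sum_{k\ge1}\frac{h_{k;a}}{(u-a_1)\cdots(u-a_k)}=H(u),\qquad h_{0;a}=1,\quad h_{k;a}=0\ (k<0).$$ For a Young diagram $\mu$ with transpose $\mu'$ and $\ell(\mu)$ rows, the multiparameter Schur function is $s_{\mu;a}=\det[h_{\mu_i-i+j;\,\tau^{1-j}a}]_{i,j=1}^{\ell(\mu)}$ (the determinant is the same for every order $\ge\ell(\mu)$). Put $e_{k;a}=s_{(1^k);a}$ for $k\ge0$ (so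 $e_{0;a}=1$) and $e_{k;a}=0$ for $k<0$. Let $\Lambda^*$ be the algebra of shifted symmetric functions, i.e. of sequences $f_n\in\mathbb C[x_1,\dots,x_n]$ of bounded degree, with $f_n$ symmetric in the variables $x_j-j$ and $f_{n+1}|_{x_{n+1}=0}=f_n$. With $x^{\downarrow m}=x(x-1)\cdots(x-m+1)$, let $s^*_\mu\in\Lambda^*$ be the shifted Schur function $$s^*_\mu(x_1,\dots,x_n)=\frac{\det[(x_i+n-i)^{\downarrow(\mu_j+n-j)}]}{\det[(x_i+n-i)^{\downarrow(n-j)}]}\quad(n\ge\ell(\mu)),$$ and put $H^*(u)=1+\sum_{k\ge1}s^*_{(k)}/u^{\downarrow k}$. Let $\varphi:\Lambda^*\to\Lambda$ be the algebra isomorphism with $\varphi(H^*(u))=H(u+\tfrac12)$. The Frobenius–Schur function is $Fs_\mu=\varphi(s^*_\mu)$, that is, the unique element of $\Lambda$ that $\varphi^{-1}$ sends to $s^*_\mu$. **Statement.** For every Young diagram $\mu$ and every sequence $a=(a_i)_{i\in\mathbb Z}$ of complex numbers: 1. (Duality) $\omega(s_{\mu;a})=s_{\mu';\hat a}$. In particular,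 since $s_{\mu;a}=Fs_\mu$ for $a_i=i-\tfrac12$ (and then $\hat a=a$), $\omega(Fs_\mu)=Fs_{\mu'}$. 2. (Generating series for the $e$-functions) $\displaystyle 1+\sum_{k\ge1}\frac{e_{k;a}}{(u-\hat a_1)\cdots(u-\hat a_k)}=E(u).$ 3. (Nägelsbach–Kostka formula) $s_{\mu;a}=\det[e_{\mu'_i-i+j;\,\tau^{j-1}a}]_{i,j=1}^{n}$ for every $n\ge\ell(\mu')$. -/

import Mathlib

namespace FrobeniusSchur

open scoped PowerSeries

noncomputable section

/-! ## Symmetric functions -/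

/-- The algebra `Λ = ℂ[p₁, p₂, …]` of symmetric functions; the variable `X k` is the power sum
`p_{k+1}`. -/
abbrev SymFun : Type := MvPolynomial ℕ ℂ

/-- The power sum `p_{k+1}`. -/
def psum (k : ℕ) : SymFun := MvPolynomial.X k

/-- `∑_{k ≥ 1} p_k t^k / k`, where `t = 1/u`. -/
def powerSumSeries : SymFun⟦X⟧ :=
  PowerSeries.mk fun n => match n with
    | 0 => 0
    | k + 1 => ((k + 1 : ℂ)⁻¹) • psum k

/-- `H(u) = 1 + ∑_{k ≥ 1} h_k u^{-k} = exp (∑_{k ≥ 1} p_k u^{-k} / k)`, as a series in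
`t = 1/u`. -/
def seriesH : SymFun⟦X⟧ := (PowerSeries.exp SymFun).subst powerSumSeries

/-- `E(u) = 1 + ∑_{k ≥ 1} e_k u^{-k} = H(-u)⁻¹`, as a series in `t = 1/u`. -/
def seriesE : SymFun⟦X⟧ := PowerSeries.invOfUnit (PowerSeries.evalNegHom seriesH) 1

/-- The duality map as an algebra endomorphism: `p_k ↦ (-1)^{k-1} p_k`. -/
def omegaHom : SymFun →ₐ[ℂ] SymFun := MvPolynomial.aeval fun k => (-1 : SymFun) ^ k * psum k

theorem omegaHom_comp_omegaHom : omegaHom.comp omegaHom = AlgHom.id ℂ SymFun := by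
  apply MvPolynomial.algHom_ext
  intro k
  simp [omegaHom, psum, ← mul_assoc, ← mul_pow]

/-- The duality map `ω : Λ → Λ`, the algebra isomorphism with `ω(p_k) = (-1)^{k-1} p_k`. -/
def omega : SymFun ≃ₐ[ℂ] SymFun :=
  AlgEquiv.ofAlgHom omegaHom omegaHom omegaHom_comp_omegaHom omegaHom_comp_omegaHom

/-! ## Expansions in inverse factorial powers -/

/-- The series `1 / ((u - a₁) ⋯ (u - a_k))` in `t = 1/u`, that is `∏_{i=1}^k t / (1 - a_i t)`. -/
def invFactorialPower (a : ℤ → ℂ) (k : ℕ) : ℂ⟦X⟧ :=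
  ∏ i ∈ Finset.range k, (PowerSeries.X * (1 - PowerSeries.C (a (i + 1)) * PowerSeries.X)⁻¹)

/-- The series `∑_{k ≥ 0} g_k / ((u - a₁) ⋯ (u - a_k))` in `t = 1/u`. The `k`-th summand is
divisible by `t^k`, so that only `k ≤ n` contribute to the coefficient of `t^n`. -/
def factorialSeries {A : Type*} [CommRing A] [Algebra ℂ A] (a : ℤ → ℂ) (g : ℕ → A) : A⟦X⟧ :=
  PowerSeries.mk fun n => ∑ k ∈ Finset.range (n + 1),
    PowerSeries.coeff n (invFactorialPower a k) • g k

theorem coeff_invFactorialPower_self (a : ℤ → ℂ) (k : ℕ) :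
    PowerSeries.coeff k (invFactorialPower a k) = 1 := by
  rw [invFactorialPower, Finset.prod_mul_distrib, Finset.prod_const, Finset.card_range]
  have := PowerSeries.coeff_X_pow_mul
    (∏ i ∈ Finset.range k, (1 - PowerSeries.C (a (i + 1)) * PowerSeries.X : ℂ⟦X⟧)⁻¹) k 0
  rw [zero_add] at this
  rw [this, PowerSeries.coeff_zero_eq_constantCoeff_apply, map_prod]
  simp

/-- Every series in `1/u` has a unique expansion in the inverse factorial powers. -/
theorem existsUnique_factorialSeries {A : Type*} [CommRing A] [Algebra ℂ A] (a : ℤ → ℂ)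
    (F : A⟦X⟧) : ∃! g : ℕ → A, factorialSeries a g = F := by
  have key : ∀ g : ℕ → A, factorialSeries a g = F ↔ ∀ n, g n = PowerSeries.coeff n F -
      ∑ k : Fin n, PowerSeries.coeff n (invFactorialPower a k) • g k := by
    intro g
    rw [PowerSeries.ext_iff]
    refine forall_congr' fun n => ?_
    rw [factorialSeries, PowerSeries.coeff_mk, Finset.sum_range_succ,
      coeff_invFactorialPower_self, one_smul, eq_sub_iff_add_eq', Finset.sum_range]
  let G : (n : ℕ) → ((m : ℕ) → m < n → A) → A := fun n g => PowerSeries.coeff n F -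
      ∑ k : Fin n, PowerSeries.coeff n (invFactorialPower a k) • g k k.2
  refine ⟨fun n => Nat.strongRec G n, ?_, ?_⟩
  · refine (key _).2 fun n => ?_
    rw [Nat.strongRec]
  · intro g hg
    replace hg := (key g).1 hg
    funext n
    induction n using Nat.strongRecOn with
    | ind n ih =>
      rw [hg n, Nat.strongRec]
      simp only [G]
      congr 1
      exact Finset.sum_congr rfl fun k _ => by rw [ih k k.2]

/-- The coefficients `g_k` in `F(u) = ∑_{k ≥ 0} g_k / ((u - a₁) ⋯ (u - a_k))`. -/
def factorialCoeff {A : Type*} [CommRing A] [Algebra ℂ A] (a : ℤ → ℂ) (F : A⟦X⟧) : ℕ → A :=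
  (existsUnique_factorialSeries a F).choose

theorem factorialSeries_factorialCoeff {A : Type*} [CommRing A] [Algebra ℂ A] (a : ℤ → ℂ)
    (F : A⟦X⟧) : factorialSeries a (factorialCoeff a F) = F :=
  (existsUnique_factorialSeries a F).choose_spec.1

/-! ## Multiparameter Schur functions -/

/-- `(τ^r a)_i = a_{i+r}`. -/
def tau (r : ℤ) (a : ℤ → ℂ) : ℤ → ℂ := fun i => a (i + r)

/-- The dual sequence `â_i = -a_{1-i}`. -/
def dualSeq (a : ℤ → ℂ) : ℤ → ℂ := fun i => -a (1 - i)

/-- `h_{k;a}`: for `k ≥ 0` through `∑_{k ≥ 0} h_{k;a} / ((u - a₁) ⋯ (u - a_k)) = H(u)`, and zero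
for `k < 0`. -/
def hMulti (k : ℤ) (a : ℤ → ℂ) : SymFun :=
  if 0 ≤ k then factorialCoeff a seriesH k.toNat else 0

/-- The determinant `det [h_{μ_i - i + j; τ^{1-j} a}]` of order `n` (rows and columns are numbered
from zero here, so `τ^{1-j}` reads `τ^{-j}`). -/
def jacobiTrudiDet (μ : YoungDiagram) (a : ℤ → ℂ) (n : ℕ) : SymFun :=
  Matrix.det (Matrix.of fun i j : Fin n =>
    hMulti ((μ.rowLen i : ℤ) - (i : ℕ) + (j : ℕ)) (tau (-((j : ℕ) : ℤ)) a))

/-- The multiparameter Schur function `s_{μ;a}`; the order of the determinant is the number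
`ℓ(μ)` of rows of `μ`. -/
def multiSchur (μ : YoungDiagram) (a : ℤ → ℂ) : SymFun := jacobiTrudiDet μ a (μ.colLen 0)

/-- The one-column diagram `(1^k)`. -/
def column (k : ℕ) : YoungDiagram where
  cells := Finset.range k ×ˢ {0}
  isLowerSet := by
    rintro ⟨i, j⟩ ⟨i', j'⟩ ⟨hi, hj⟩ h
    simp only [Finset.coe_product, Set.mem_prod, Finset.mem_coe, Finset.mem_range,
      Finset.mem_singleton] at h ⊢
    simp only at hi hj
    omega

/-- `e_{k;a} = s_{(1^k);a}` for `k ≥ 0`, and zero for `k < 0`. -/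
def eMulti (k : ℤ) (a : ℤ → ℂ) : SymFun :=
  if 0 ≤ k then multiSchur (column k.toNat) a else 0

theorem constantCoeff_subst_of_zero {A : Type*} [CommRing A] {g : A⟦X⟧}
    (hg : PowerSeries.constantCoeff g = 0) (f : A⟦X⟧) :
    PowerSeries.constantCoeff (f.subst g) = PowerSeries.constantCoeff f := by
  have hs : PowerSeries.HasSubst g := PowerSeries.HasSubst.of_constantCoeff_zero' hg
  have h := PowerSeries.constantCoeff_subst_eq_zero hg
    (f - PowerSeries.C (PowerSeries.constantCoeff f)) (by simp)
  rw [← PowerSeries.coe_substAlgHom hs, map_sub, PowerSeries.coe_substAlgHom hs] at h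
  have h2 : (PowerSeries.C (PowerSeries.constantCoeff f) : A⟦X⟧).subst g
      = PowerSeries.C (PowerSeries.constantCoeff f) := by
    rw [← PowerSeries.coe_substAlgHom hs]
    exact (PowerSeries.substAlgHom hs).commutes _
  rw [h2, map_sub, sub_eq_zero] at h
  refine Eq.trans h ?_
  exact PowerSeries.constantCoeff_C _

theorem constantCoeff_powerSumSeries : PowerSeries.constantCoeff powerSumSeries = 0 := by
  rw [← PowerSeries.coeff_zero_eq_constantCoeff_apply]
  simp [powerSumSeries]

theorem constantCoeff_seriesH : PowerSeries.constantCoeff seriesH = 1 := by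
  rw [seriesH, constantCoeff_subst_of_zero constantCoeff_powerSumSeries]
  simp

theorem seriesH_mul_seriesE_neg : seriesH * PowerSeries.evalNegHom seriesE = 1 := by
  have h : PowerSeries.evalNegHom seriesH * seriesE = 1 :=
    PowerSeries.mul_invOfUnit _ 1 (by
      rw [← PowerSeries.coeff_zero_eq_constantCoeff_apply, PowerSeries.evalNegHom,
        PowerSeries.coeff_rescale]
      simp [constantCoeff_seriesH])
  have h2 := congrArg PowerSeries.evalNegHom h
  rw [map_mul, map_one] at h2
  convert h2 using 2
  rw [PowerSeries.evalNegHom, PowerSeries.rescale_rescale]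
  simp [PowerSeries.rescale_one]

theorem factorialCoeff_seriesH_zero (a : ℤ → ℂ) : factorialCoeff a seriesH 0 = 1 := by
  have h := congrArg (PowerSeries.coeff 0) (factorialSeries_factorialCoeff a seriesH)
  rw [PowerSeries.coeff_zero_eq_constantCoeff_apply (φ := seriesH), constantCoeff_seriesH] at h
  simpa [factorialSeries, coeff_invFactorialPower_self, invFactorialPower] using h

/-- The order of the determinant that defines `s_{μ;a}` may be any number `≥ ℓ(μ)`. -/
theorem jacobiTrudiDet_eq (μ : YoungDiagram) (a : ℤ → ℂ) (n : ℕ) (hn : μ.colLen 0 ≤ n) :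
    jacobiTrudiDet μ a n = multiSchur μ a := by
  induction n, hn using Nat.le_induction with
  | base => rfl
  | succ n hn ih =>
    rw [← ih]
    have h0 : μ.rowLen n = 0 := by
      by_contra h
      have : (n, 0) ∈ μ := YoungDiagram.mem_iff_lt_rowLen.2 (Nat.pos_of_ne_zero h)
      have := YoungDiagram.mem_iff_lt_colLen.1 this
      omega
    rw [jacobiTrudiDet, Matrix.det_succ_row _ (Fin.last n), Finset.sum_eq_single (Fin.last n)]
    · simp only [Matrix.of_apply, Fin.val_last, h0, Fin.succAbove_last]
      rw [hMulti]
      simp [factorialCoeff_seriesH_zero, ← two_mul, jacobiTrudiDet]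
      rfl
    · intro j _ hj
      have : (j : ℕ) < n := Fin.val_lt_last hj
      simp only [Matrix.of_apply, Fin.val_last, h0]
      rw [hMulti, if_neg (by push_cast; omega)]
      simp
    · simp

theorem exp_subst_logOf {A : Type*} [CommRing A] [Algebra ℚ A] {G : A⟦X⟧}
    (hG : PowerSeries.constantCoeff G = 1) :
    (PowerSeries.exp A).subst (PowerSeries.logOf G) = G := by
  have : IsAddTorsionFree A := IsAddTorsionFree.of_module_rat A
  have hs1 : PowerSeries.HasSubst (G - 1) :=
    PowerSeries.HasSubst.of_constantCoeff_zero' (by simp [hG])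
  have hs2 : PowerSeries.HasSubst (PowerSeries.logOf G) :=
    PowerSeries.HasSubst.of_constantCoeff_zero' (PowerSeries.constantCoeff_logOf hG)
  set Y := (PowerSeries.exp A).subst (PowerSeries.logOf G) with hY
  set K := (PowerSeries.mk fun n ↦ algebraMap ℚ A ((-1 : ℚ) ^ n)).subst (G - 1) with hK
  have hgeo : (PowerSeries.mk fun n ↦ algebraMap ℚ A ((-1 : ℚ) ^ n)) * (1 + PowerSeries.X) = 1 := by
    ext n
    cases n with
    | zero => simp [mul_add]
    | succ n => simp [mul_add, PowerSeries.coeff_one, pow_succ]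
  have hKG : K * G = 1 := by
    have := congrArg (PowerSeries.substAlgHom hs1) hgeo
    simp only [map_mul, map_add, map_one, PowerSeries.substAlgHom_X] at this
    rw [PowerSeries.coe_substAlgHom] at this
    simpa [hK] using this
  have hL : PowerSeries.derivative A (PowerSeries.logOf G) = K * PowerSeries.derivative A G := by
    rw [PowerSeries.logOf_eq, PowerSeries.derivative_subst hs1, PowerSeries.deriv_log]
    simp [hK]
  have hY' : PowerSeries.derivative A Y = Y * (K * PowerSeries.derivative A G) := by
    rw [hY, PowerSeries.derivative_subst hs2, PowerSeries.derivative_exp, hL]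
  have hK' : PowerSeries.derivative A K = - (K * K * PowerSeries.derivative A G) := by
    have := congrArg (PowerSeries.derivative A) hKG
    rw [Derivation.leibniz] at this
    simp only [smul_eq_mul, PowerSeries.derivative_one] at this
    linear_combination K * this - PowerSeries.derivative A K * hKG
  have hYc : PowerSeries.constantCoeff Y = 1 := by
    rw [hY, constantCoeff_subst_of_zero (PowerSeries.constantCoeff_logOf hG)]
    simp
  have hKc : PowerSeries.constantCoeff K = 1 := by
    rw [hK, constantCoeff_subst_of_zero (by simp [hG]),
      ← PowerSeries.coeff_zero_eq_constantCoeff_apply]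
    simp
  have hYK : Y * K = 1 := by
    refine PowerSeries.derivative.ext ?_ ?_
    · rw [Derivation.leibniz, hY', hK']
      simp only [smul_eq_mul, PowerSeries.derivative_one]
      ring
    · simp [hYc, hKc]
  linear_combination G * hYK - Y * hKG

open Finset in
/-- The determinant `det [p_j(y_i)]` is divisible by the Vandermonde determinant of the `y_i`. -/
theorem vandermonde_dvd_det {R : Type*} [CommRing R] : ∀ (n : ℕ) (y : Fin n → R)
    (p : Fin n → Polynomial R),
    (Matrix.vandermonde y).det ∣ (Matrix.of fun i j => (p j).eval (y i)).det := by
  intro n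
  simp only [Matrix.det_vandermonde]
  induction n with
  | zero => intro y p; simp
  | succ n ih =>
    intro y p
    rw [Fin.prod_univ_succ, Fin.prod_Ioi_zero]
    simp only [Fin.prod_Ioi_succ]
    choose q hq using fun j => Polynomial.X_sub_C_dvd_sub_C_eval (a := y 0) (p := p j)
    have hq' : ∀ (i : Fin n) j, (p j).eval (y i.succ) - (p j).eval (y 0) =
        (y i.succ - y 0) * (q j).eval (y i.succ) := by
      intro i j
      have := congrArg (Polynomial.eval (y i.succ)) (hq j)
      simpa using this
    let c : Fin (n + 1) → R := Fin.cases 1 fun i => y i.succ - y 0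
    let B : Matrix (Fin (n + 1)) (Fin (n + 1)) R := Matrix.of fun i j =>
      (Fin.cases ((p j).eval (y 0)) (fun i => (q j).eval (y i.succ)) i : R)
    have hB : (Matrix.of fun i j => (p j).eval (y i)).det
        = (Matrix.of fun i j => c i * B i j).det := by
      refine Matrix.det_eq_of_forall_row_eq_smul_add_const
        (fun i => Fin.cases 0 (fun _ => 1) i) 0 rfl ?_
      intro i j
      refine Fin.cases ?_ (fun i => ?_) i
      · simp [B, c]
      · simp [B, c, ← hq']
    rw [hB, Matrix.det_mul_column, Fin.prod_univ_succ]
    simp only [c, Fin.cases_zero, Fin.cases_succ, one_mul]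
    refine mul_dvd_mul_left _ ?_
    rw [Matrix.det_succ_row_zero]
    refine Finset.dvd_sum fun j _ => Dvd.dvd.mul_left ?_ _
    exact ih (fun i => y i.succ) (fun k => q (j.succAbove k))

/-! ## Shifted symmetric functions -/

/-- The substitution `x_j ↦ x_j + j` (`j = 1, …, n`; the index of `Fin n` starts at zero). -/
def shiftHom (n : ℕ) : MvPolynomial (Fin n) ℂ →ₐ[ℂ] MvPolynomial (Fin n) ℂ :=
  MvPolynomial.aeval fun j => MvPolynomial.X j + MvPolynomial.C ((j : ℂ) + 1)

/-- The algebra `Λ*_n` of polynomials in `x₁, …, x_n` that are symmetric in the shifted variables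
`x_j - j`: the polynomials `f` such that `f(x₁ + 1, …, x_n + n)` is symmetric. -/
def shiftedSymPoly (n : ℕ) : Subalgebra ℂ (MvPolynomial (Fin n) ℂ) :=
  (MvPolynomial.symmetricSubalgebra (Fin n) ℂ).comap (shiftHom n)

/-- The projection `ℂ[x₁, …, x_{n+1}] → ℂ[x₁, …, x_n]`, `x_{n+1} ↦ 0`. -/
def setLastZero (n : ℕ) : MvPolynomial (Fin (n + 1)) ℂ →ₐ[ℂ] MvPolynomial (Fin n) ℂ :=
  MvPolynomial.aeval (Fin.lastCases 0 MvPolynomial.X)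

/-- The algebra `Λ*` of shifted symmetric functions, the projective limit of the `Λ*_n` as filtered
algebras: compatible sequences `f_n ∈ Λ*_n` of bounded degree. -/
def ShiftedSym : Subalgebra ℂ ((n : ℕ) → MvPolynomial (Fin n) ℂ) where
  carrier := {f | (∀ n, f n ∈ shiftedSymPoly n) ∧ (∀ n, setLastZero n (f (n + 1)) = f n) ∧
    ∃ d, ∀ n, (f n).totalDegree ≤ d}
  mul_mem' := by
    rintro f g ⟨hf, hf', d, hd⟩ ⟨hg, hg', e, he⟩
    refine ⟨fun n => mul_mem (hf n) (hg n), fun n => ?_, d + e, fun n => ?_⟩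
    · simp only [Pi.mul_apply, map_mul, hf', hg']
    · exact (MvPolynomial.totalDegree_mul _ _).trans (add_le_add (hd n) (he n))
  add_mem' := by
    rintro f g ⟨hf, hf', d, hd⟩ ⟨hg, hg', e, he⟩
    refine ⟨fun n => add_mem (hf n) (hg n), fun n => ?_, max d e, fun n => ?_⟩
    · simp only [Pi.add_apply, map_add, hf', hg']
    · exact (MvPolynomial.totalDegree_add _ _).trans (max_le_max (hd n) (he n))
  algebraMap_mem' c := by
    refine ⟨fun n => (shiftedSymPoly n).algebraMap_mem c, fun n => ?_, 0, fun n => ?_⟩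
    · simp only [Pi.algebraMap_apply, AlgHom.commutes]
    · simp [Pi.algebraMap_apply, MvPolynomial.algebraMap_eq]

/-- `x_i + n - i` for `i = 1, …, n`; here `i.rev` is `n - i`. -/
def stairVar {n : ℕ} (i : Fin n) : MvPolynomial (Fin n) ℂ :=
  MvPolynomial.X i + MvPolynomial.C ((i.rev : ℕ) : ℂ)

/-- `det [(x_i + n - i)^{↓ κ_j}]`, with falling factorial powers. -/
def alternant (n : ℕ) (κ : Fin n → ℕ) : MvPolynomial (Fin n) ℂ :=
  Matrix.det (Matrix.of fun i j : Fin n =>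
    (descPochhammer (MvPolynomial (Fin n) ℂ) (κ j)).eval (stairVar i))

/-- The numerator `det [(x_i + n - i)^{↓ (μ_j + n - j)}]` of `s*_μ(x₁, …, x_n)`. -/
def shiftedNum (μ : YoungDiagram) (n : ℕ) : MvPolynomial (Fin n) ℂ :=
  alternant n fun j => μ.rowLen j + (j.rev : ℕ)

/-- The denominator `det [(x_i + n - i)^{↓ (n - j)}]` of `s*_μ(x₁, …, x_n)`. -/
def shiftedDen (n : ℕ) : MvPolynomial (Fin n) ℂ := alternant n fun j => (j.rev : ℕ)

theorem alternant_eq_rev (n : ℕ) (κ : Fin n → ℕ) : alternant n κ =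
    Matrix.det (Matrix.of fun i j : Fin n =>
      (descPochhammer (MvPolynomial (Fin n) ℂ) (κ j.rev)).eval (stairVar i.rev)) := by
  rw [alternant, ← Matrix.det_submatrix_equiv_self Fin.revPerm]
  rfl

theorem shiftedDen_eq (n : ℕ) : shiftedDen n =
    (Matrix.vandermonde fun i : Fin n => stairVar i.rev).det := by
  rw [shiftedDen, alternant_eq_rev]
  simp only [Fin.rev_rev]
  exact (Matrix.det_eval_matrixOfPolynomials_eq_det_vandermonde _
    (fun j : Fin n => descPochhammer (MvPolynomial (Fin n) ℂ) j)
    (fun i => descPochhammer_natDegree _ _) (fun i => monic_descPochhammer _ _)).symm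

theorem shiftedDen_dvd (n : ℕ) (κ : Fin n → ℕ) : shiftedDen n ∣ alternant n κ := by
  rw [shiftedDen_eq, alternant_eq_rev]
  exact vandermonde_dvd_det n _ fun j => descPochhammer (MvPolynomial (Fin n) ℂ) (κ j.rev)

theorem coeff_single_C {n : ℕ} (i : Fin n) (c : ℂ) :
    MvPolynomial.coeff (Finsupp.single i 1) (MvPolynomial.C c) = 0 := by
  rw [MvPolynomial.coeff_C, if_neg fun h => by simpa using DFunLike.congr_fun h i]

theorem coeff_single_stairVar {n : ℕ} (i j : Fin n) :
    MvPolynomial.coeff (Finsupp.single i 1) (stairVar j) = if j = i then 1 else 0 := by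
  rw [stairVar, MvPolynomial.coeff_add, coeff_single_C, MvPolynomial.coeff_X, add_zero]
  simp [Finsupp.single_left_inj, eq_comm]

theorem stairVar_injective (n : ℕ) : Function.Injective (stairVar (n := n)) := by
  intro i j h
  by_contra hij
  have h2 := congrArg (MvPolynomial.coeff (Finsupp.single i 1)) h
  simp [coeff_single_stairVar, Ne.symm hij] at h2

theorem shiftedDen_ne_zero (n : ℕ) : shiftedDen n ≠ 0 := by
  rw [shiftedDen_eq, Matrix.det_vandermonde_ne_zero_iff]
  exact (stairVar_injective n).comp Fin.rev_injective

/-- The shifted Schur polynomial `s*_μ(x₁, …, x_n)`: for `n ≥ ℓ(μ)` the exact quotient of the two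
determinants; it is zero for `n < ℓ(μ)`, as stability requires. -/
def sstarPoly (μ : YoungDiagram) (n : ℕ) : MvPolynomial (Fin n) ℂ :=
  if μ.colLen 0 ≤ n then (shiftedDen_dvd n fun j => μ.rowLen j + (j.rev : ℕ)).choose else 0

theorem sstarPoly_mul (μ : YoungDiagram) (n : ℕ) (hn : μ.colLen 0 ≤ n) :
    sstarPoly μ n * shiftedDen n = shiftedNum μ n := by
  rw [sstarPoly, if_pos hn, mul_comm]
  exact (shiftedDen_dvd n fun j => μ.rowLen j + (j.rev : ℕ)).choose_spec.symm

theorem map_alternant {R : Type*} [CommRing R] {n : ℕ} (g : MvPolynomial (Fin n) ℂ →+* R)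
    (κ : Fin n → ℕ) (v : Fin n → R) (hv : ∀ i, g (stairVar i) = v i) :
    g (alternant n κ) = Matrix.det (Matrix.of fun i j : Fin n =>
        (descPochhammer R (κ j)).eval (v i)) := by
  rw [alternant, RingHom.map_det]
  congr 1
  ext1 i j
  simp only [RingHom.mapMatrix_apply, Matrix.map_apply, Matrix.of_apply]
  rw [← hv, ← descPochhammer_map g (κ j), Polynomial.eval_map_apply]

theorem shiftHom_stairVar (n : ℕ) (i : Fin n) :
    shiftHom n (stairVar i) = MvPolynomial.X i + MvPolynomial.C (n : ℂ) := by
  simp only [shiftHom, stairVar, map_add, MvPolynomial.aeval_X, MvPolynomial.aeval_C,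
    MvPolynomial.algebraMap_eq]
  rw [add_assoc, ← map_add MvPolynomial.C, ← map_add MvPolynomial.C]
  have : ((i : ℕ) : ℂ) + 1 + ((i.rev : ℕ) : ℂ) = ((i + 1 + i.rev : ℕ) : ℂ) := by push_cast; ring
  rw [this, Fin.val_rev, show (i : ℕ) + 1 + (n - (i + 1)) = n by omega]

theorem rename_shiftHom_alternant (n : ℕ) (κ : Fin n → ℕ) (σ : Equiv.Perm (Fin n)) :
    MvPolynomial.rename σ (shiftHom n (alternant n κ)) =
    ((Equiv.Perm.sign σ : ℤ) : MvPolynomial (Fin n) ℂ) * shiftHom n (alternant n κ) := by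
  have h1 := map_alternant (shiftHom n : MvPolynomial (Fin n) ℂ →+* MvPolynomial (Fin n) ℂ) κ
    _ (shiftHom_stairVar n)
  have h2 := map_alternant
    (((MvPolynomial.rename (R := ℂ) σ).comp (shiftHom n) :) :
      MvPolynomial (Fin n) ℂ →+* MvPolynomial (Fin n) ℂ) κ
    (fun i => MvPolynomial.X (σ i) + MvPolynomial.C (n : ℂ)) (fun i => by
      simp [shiftHom_stairVar])
  have h3 := Matrix.det_permute σ (Matrix.of fun i j : Fin n =>
        (descPochhammer (MvPolynomial (Fin n) ℂ) (κ j)).eval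
          (MvPolynomial.X i + MvPolynomial.C (n : ℂ)))
  exact h2.trans (h3.trans (congrArg _ h1.symm))

theorem sstarPoly_mem (μ : YoungDiagram) (n : ℕ) : sstarPoly μ n ∈ shiftedSymPoly n := by
  by_cases hn : μ.colLen 0 ≤ n
  · intro σ
    change MvPolynomial.rename σ (shiftHom n (sstarPoly μ n)) = shiftHom n (sstarPoly μ n)
    have h := congrArg (shiftHom n) (sstarPoly_mul μ n hn)
    rw [map_mul] at h
    have h' := congrArg (MvPolynomial.rename σ) h
    rw [map_mul, shiftedDen, shiftedNum, rename_shiftHom_alternant, rename_shiftHom_alternant,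
      ← shiftedDen, ← shiftedNum, ← h] at h'
    have hd : shiftHom n (shiftedDen n) ≠ 0 := by
      have hinv : (MvPolynomial.aeval fun j : Fin n => (MvPolynomial.X j -
          MvPolynomial.C ((j : ℂ) + 1) : MvPolynomial (Fin n) ℂ)).comp (shiftHom n) =
          AlgHom.id ℂ _ := by
        apply MvPolynomial.algHom_ext
        intro j
        simp only [shiftHom, AlgHom.comp_apply, map_add, MvPolynomial.aeval_X,
          MvPolynomial.aeval_C, MvPolynomial.algebraMap_eq, AlgHom.id_apply]
        ring
      intro h0
      have := AlgHom.congr_fun hinv (shiftedDen n)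
      rw [AlgHom.comp_apply, h0, map_zero] at this
      exact shiftedDen_ne_zero n this.symm
    have hs : ((Equiv.Perm.sign σ : ℤ) : MvPolynomial (Fin n) ℂ) ≠ 0 := by
      exact_mod_cast (Equiv.Perm.sign σ).ne_zero
    refine mul_right_cancel₀ (mul_ne_zero hs hd) ?_
    linear_combination h'
  · rw [sstarPoly, if_neg hn]
    exact zero_mem _

theorem setLastZero_stairVar_castSucc (n : ℕ) (i : Fin n) :
    setLastZero n (stairVar i.castSucc) = stairVar i + 1 := by
  have : ((i.castSucc.rev : ℕ) : ℂ) = (i.rev : ℕ) + 1 := by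
    have : (i.castSucc.rev : ℕ) = i.rev + 1 := by
      rw [Fin.val_rev, Fin.val_rev, Fin.val_castSucc]; omega
    rw [this]; push_cast; rfl
  simp only [setLastZero, stairVar, map_add, MvPolynomial.aeval_X, MvPolynomial.aeval_C,
    MvPolynomial.algebraMap_eq, Fin.lastCases_castSucc, this, map_one, add_assoc]

theorem setLastZero_stairVar_last (n : ℕ) :
    setLastZero n (stairVar (Fin.last n)) = 0 := by
  simp [setLastZero, stairVar]

theorem setLastZero_alternant (n : ℕ) (κ : Fin (n + 1) → ℕ) :
    setLastZero n (alternant (n + 1) κ) = Matrix.det (Matrix.of fun i j : Fin (n + 1) =>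
        (descPochhammer (MvPolynomial (Fin n) ℂ) (κ j)).eval
          (Fin.lastCases (motive := fun _ => MvPolynomial (Fin n) ℂ) 0
            (fun i => stairVar i + 1) i)) := by
  refine map_alternant (setLastZero n : MvPolynomial (Fin (n + 1)) ℂ →+* MvPolynomial (Fin n) ℂ)
    κ _ fun i => ?_
  refine Fin.lastCases ?_ (fun i => ?_) i
  · rw [Fin.lastCases_last]; exact setLastZero_stairVar_last n
  · rw [Fin.lastCases_castSucc]; exact setLastZero_stairVar_castSucc n i

theorem setLastZero_alternant_eq_zero (n : ℕ) (κ : Fin (n + 1) → ℕ) (hκ : ∀ j, κ j ≠ 0) :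
    setLastZero n (alternant (n + 1) κ) = 0 := by
  rw [setLastZero_alternant]
  refine Matrix.det_eq_zero_of_row_eq_zero (Fin.last n) fun j => ?_
  simp [hκ j]

theorem setLastZero_alternant_succ (n : ℕ) (κ : Fin (n + 1) → ℕ) (κ' : Fin n → ℕ)
    (h : ∀ j : Fin n, κ j.castSucc = κ' j + 1) (hl : κ (Fin.last n) = 0) :
    setLastZero n (alternant (n + 1) κ) = (∏ i : Fin n, (stairVar i + 1)) * alternant n κ' := by
  rw [setLastZero_alternant, Matrix.det_succ_row _ (Fin.last n),
    Finset.sum_eq_single (Fin.last n)]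
  · simp only [Matrix.of_apply, Fin.val_last, Fin.lastCases_last, hl, Fin.succAbove_last,
      descPochhammer_zero, Polynomial.eval_one, mul_one]
    rw [← two_mul, pow_mul, neg_one_sq, one_pow, one_mul, alternant, ← Matrix.det_mul_column]
    congr 1
    ext1 i j
    simp [h, descPochhammer_succ_left]
  · intro j _ hj
    obtain ⟨j, rfl⟩ := Fin.exists_castSucc_eq.2 hj
    simp [h]
  · simp

theorem setLastZero_shiftedDen (n : ℕ) : setLastZero n (shiftedDen (n + 1)) =
    (∏ i : Fin n, (stairVar i + 1)) * shiftedDen n := by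
  refine setLastZero_alternant_succ n _ _ (fun j => ?_) (by simp)
  rw [Fin.val_rev, Fin.val_rev, Fin.val_castSucc]; omega

theorem prod_stairVar_ne_zero (n : ℕ) :
    (∏ i : Fin n, (stairVar i + 1 : MvPolynomial (Fin n) ℂ)) ≠ 0 := by
  refine Finset.prod_ne_zero_iff.2 fun i _ h => ?_
  have h2 := congrArg (MvPolynomial.coeff (Finsupp.single i 1)) h
  rw [← map_one MvPolynomial.C, MvPolynomial.coeff_add, coeff_single_C,
    coeff_single_stairVar] at h2
  simp at h2

theorem rowLen_eq_zero {μ : YoungDiagram} {i : ℕ} (h : μ.colLen 0 ≤ i) : μ.rowLen i = 0 := by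
  by_contra h'
  have := YoungDiagram.mem_iff_lt_colLen.1
    (YoungDiagram.mem_iff_lt_rowLen.2 (Nat.pos_of_ne_zero h'))
  omega

theorem sstarPoly_stable (μ : YoungDiagram) (n : ℕ) :
    setLastZero n (sstarPoly μ (n + 1)) = sstarPoly μ n := by
  by_cases hn1 : μ.colLen 0 ≤ n + 1
  · have h := congrArg (setLastZero n) (sstarPoly_mul μ (n + 1) hn1)
    rw [map_mul, setLastZero_shiftedDen] at h
    have hne := mul_ne_zero (prod_stairVar_ne_zero n) (shiftedDen_ne_zero n)
    by_cases hn : μ.colLen 0 ≤ n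
    · rw [shiftedNum, setLastZero_alternant_succ n _ (fun j => μ.rowLen j + (j.rev : ℕ)),
        ← shiftedNum, ← sstarPoly_mul μ n hn] at h
      · refine mul_right_cancel₀ hne ?_
        linear_combination h
      · intro j
        rw [Fin.val_rev, Fin.val_rev, Fin.val_castSucc]; omega
      · simp [rowLen_eq_zero hn]
    · rw [shiftedNum, setLastZero_alternant_eq_zero] at h
      · rw [(mul_eq_zero.1 h).resolve_right hne, sstarPoly, if_neg hn]
      · intro j
        have : (j : ℕ) < μ.colLen 0 := by omega
        have := YoungDiagram.mem_iff_lt_rowLen.1 (YoungDiagram.mem_iff_lt_colLen.2 this)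
        omega
  · rw [sstarPoly, sstarPoly, if_neg hn1, if_neg (by omega), map_zero]

theorem totalDegree_alternant_le (n : ℕ) (κ : Fin n → ℕ) :
    (alternant n κ).totalDegree ≤ ∑ j, κ j := by
  have hx : ∀ i : Fin n, (stairVar i).totalDegree ≤ 1 := fun i =>
    (MvPolynomial.totalDegree_add _ _).trans
      (by rw [MvPolynomial.totalDegree_X, MvPolynomial.totalDegree_C]; exact le_rfl)
  have hp : ∀ (i : Fin n) (k : ℕ), ((descPochhammer (MvPolynomial (Fin n) ℂ) k).eval
      (stairVar i)).totalDegree ≤ k := by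
    intro i k
    induction k with
    | zero => simp
    | succ k ih =>
      rw [descPochhammer_succ_right, Polynomial.eval_mul]
      refine (MvPolynomial.totalDegree_mul _ _).trans (add_le_add ih ?_)
      simp only [Polynomial.eval_sub, Polynomial.eval_X, Polynomial.eval_natCast]
      rw [← map_natCast (MvPolynomial.C (σ := Fin n) (R := ℂ))]
      exact (MvPolynomial.totalDegree_sub_C_le _ _).trans (hx i)
  rw [alternant, Matrix.det_apply]
  refine MvPolynomial.totalDegree_finsetSum_le fun σ _ => ?_
  refine (MvPolynomial.totalDegree_smul_le _ _).trans ?_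
  refine (MvPolynomial.totalDegree_finsetProd _ _).trans ?_
  exact Finset.sum_le_sum fun j _ => hp _ _

theorem totalDegree_shiftedDen (n : ℕ) : ∑ j : Fin n, (j.rev : ℕ) ≤ (shiftedDen n).totalDegree := by
  have hx : ∀ i j : Fin n, i ≠ j →
      1 ≤ (stairVar j - stairVar i : MvPolynomial (Fin n) ℂ).totalDegree := by
    intro i j hij
    by_contra! h
    have h0 := MvPolynomial.totalDegree_eq_zero_iff_eq_C.1 (Nat.lt_one_iff.1 h)
    have h2 := congrArg (MvPolynomial.coeff (Finsupp.single j 1)) h0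
    rw [coeff_single_C, MvPolynomial.coeff_sub, coeff_single_stairVar,
      coeff_single_stairVar, if_pos rfl, if_neg hij] at h2
    simp at h2
  have hdeg : ∀ (s : Finset (Fin n × Fin n)), (∀ p ∈ s, p.1 ≠ p.2) →
      s.card ≤ (∏ p ∈ s, (stairVar p.2.rev - stairVar p.1.rev :
        MvPolynomial (Fin n) ℂ)).totalDegree := by
    intro s hs
    induction s using Finset.induction_on with
    | empty => simp
    | insert p s hp ih =>
      have hne : ∀ q ∈ insert p s, (stairVar q.2.rev - stairVar q.1.rev :
          MvPolynomial (Fin n) ℂ) ≠ 0 := by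
        intro q hq h
        have := hx q.1.rev q.2.rev (fun h => hs q hq (Fin.rev_injective h))
        rw [h] at this
        simp at this
      rw [Finset.prod_insert hp, Finset.card_insert_of_notMem hp,
        MvPolynomial.totalDegree_mul_of_isDomain (hne p (Finset.mem_insert_self _ _))
          (Finset.prod_ne_zero_iff.2 fun q hq => hne q (Finset.mem_insert_of_mem hq)), add_comm]
      exact add_le_add (hx _ _ fun h => hs p (Finset.mem_insert_self _ _) (Fin.rev_injective h))
        (ih fun q hq => hs q (Finset.mem_insert_of_mem hq))
  have h := hdeg (Finset.univ.filter fun p : Fin n × Fin n => p.1 < p.2)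
    (fun p hp => ((Finset.mem_filter.1 hp).2).ne)
  rw [shiftedDen_eq, Matrix.det_vandermonde]
  rw [Finset.prod_filter, Finset.card_filter, Fintype.sum_prod_type, Fintype.prod_prod_type] at h
  have h1 : ∀ x : Fin n, (∑ y : Fin n, if x < y then 1 else 0) = (x.rev : ℕ) := by
    intro x
    rw [← Finset.card_filter, Finset.filter_lt_eq_Ioi, Fin.card_Ioi, Fin.val_rev]
    omega
  simp only [h1] at h
  refine h.trans (le_of_eq ?_)
  congr 1
  refine Finset.prod_congr rfl fun x _ => ?_
  rw [← Finset.prod_filter, Finset.filter_lt_eq_Ioi]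

theorem sstarPoly_degree (μ : YoungDiagram) (n : ℕ) :
    (sstarPoly μ n).totalDegree ≤ ∑ i ∈ Finset.range (μ.colLen 0), μ.rowLen i := by
  by_cases hn : μ.colLen 0 ≤ n
  · by_cases h0 : sstarPoly μ n = 0
    · simp [h0]
    have h := congrArg MvPolynomial.totalDegree (sstarPoly_mul μ n hn)
    rw [MvPolynomial.totalDegree_mul_of_isDomain h0 (shiftedDen_ne_zero n)] at h
    have h1 := totalDegree_alternant_le n fun j => μ.rowLen j + (j.rev : ℕ)
    rw [← shiftedNum, ← h, Finset.sum_add_distrib] at h1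
    have h2 := totalDegree_shiftedDen n
    have h3 : ∑ j : Fin n, μ.rowLen j = ∑ i ∈ Finset.range (μ.colLen 0), μ.rowLen i := by
      rw [Fin.sum_univ_eq_sum_range fun j => μ.rowLen j]
      refine (Finset.sum_subset (Finset.range_mono hn) fun i _ hi => ?_).symm
      exact rowLen_eq_zero (by simpa using hi)
    omega
  · simp [sstarPoly, hn]

/-- The shifted Schur function `s*_μ ∈ Λ*`. -/
def sstar (μ : YoungDiagram) : ShiftedSym :=
  ⟨sstarPoly μ, sstarPoly_mem μ, sstarPoly_stable μ, _, sstarPoly_degree μ⟩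

/-- `h*_k = s*_{(k)}`. -/
def hStar (k : ℕ) : ShiftedSym := sstar (column k).transpose

/-- The series `H*(u - c) = 1 + ∑_{k ≥ 1} h*_k / (u - c)^{↓k}` in `t = 1/u`, where
`(u - c)^{↓k} = (u - c)(u - c - 1) ⋯ (u - c - k + 1)`. -/
def seriesHStar (c : ℂ) : ShiftedSym⟦X⟧ := factorialSeries (fun i => c + i - 1) hStar

theorem hStar_zero : hStar 0 = 1 := by
  have hr : ∀ i, (column 0).transpose.rowLen i = 0 := by
    intro i
    by_contra h
    have := YoungDiagram.mem_iff_lt_rowLen.2 (Nat.pos_of_ne_zero h)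
    rw [YoungDiagram.mem_transpose] at this
    simp [column, ← YoungDiagram.mem_cells] at this
  have hc : (column 0).transpose.colLen 0 = 0 := by
    by_contra h
    have := YoungDiagram.mem_iff_lt_rowLen.1
      (YoungDiagram.mem_iff_lt_colLen.2 (Nat.pos_of_ne_zero h))
    rw [hr] at this
    omega
  apply Subtype.ext
  funext n
  have h := sstarPoly_mul (column 0).transpose n (by omega)
  simp only [shiftedNum, hr, zero_add] at h
  exact mul_right_cancel₀ (shiftedDen_ne_zero n) (h.trans (one_mul _).symm)

/-- The algebra homomorphism `ψ : Λ → Λ*` with `ψ(H(u)) = H*(u - 1/2)`. Since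
`∑_{k ≥ 1} p_k u^{-k} / k = log H(u)`, it sends `p_k` to `k` times the coefficient of `u^{-k}` in
`log H*(u - 1/2)`. -/
def psi : SymFun →ₐ[ℂ] ShiftedSym :=
  MvPolynomial.aeval fun k =>
    (k + 1 : ℂ) • PowerSeries.coeff (k + 1) (PowerSeries.logOf (seriesHStar (1 / 2)))

theorem map_psi_seriesH :
    PowerSeries.map (psi : SymFun →+* ShiftedSym) seriesH = seriesHStar (1 / 2) := by
  have hG : PowerSeries.constantCoeff (seriesHStar (1 / 2)) = 1 := by
    rw [← PowerSeries.coeff_zero_eq_constantCoeff_apply, seriesHStar, factorialSeries]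
    simp [hStar_zero, invFactorialPower]
  have hs : PowerSeries.HasSubst powerSumSeries :=
    PowerSeries.HasSubst.of_constantCoeff_zero' constantCoeff_powerSumSeries
  have h := PowerSeries.map_subst hs (h := (psi : SymFun →+* ShiftedSym))
    (PowerSeries.exp SymFun)
  refine h.trans ?_
  rw [PowerSeries.map_exp]
  have hP : PowerSeries.map (psi : SymFun →+* ShiftedSym) powerSumSeries =
      PowerSeries.logOf (seriesHStar (1 / 2)) := by
    ext1 n
    cases n with
    | zero =>
      rw [PowerSeries.coeff_zero_eq_constantCoeff_apply, PowerSeries.coeff_zero_eq_constantCoeff_apply,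
        PowerSeries.constantCoeff_logOf hG, ← PowerSeries.coeff_zero_eq_constantCoeff_apply,
        PowerSeries.coeff_map, PowerSeries.coeff_zero_eq_constantCoeff_apply,
        constantCoeff_powerSumSeries, map_zero]
    | succ k =>
      have hk : (k + 1 : ℂ) ≠ 0 := by exact_mod_cast k.succ_ne_zero
      simp only [powerSumSeries, PowerSeries.coeff_map, PowerSeries.coeff_mk]
      change psi _ = _
      rw [map_smul, psum, psi, MvPolynomial.aeval_X, smul_smul, inv_mul_cancel₀ hk, one_smul]
  exact (congrArg (fun P => (PowerSeries.exp ShiftedSym).subst P) hP).trans (exp_subst_logOf hG)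

/-- The map `φ : Λ* → Λ` with `φ(H*(u)) = H(u + 1/2)`: the inverse of `ψ`. -/
def phi : ShiftedSym → SymFun := Function.invFun psi

/-- The Frobenius–Schur function `Fs_μ = φ(s*_μ)`. -/
def frobeniusSchur (μ : YoungDiagram) : SymFun := phi (sstar μ)

end

end FrobeniusSchur

/-! Everything about `h_{k;a}` rests on a residue description: for k ≥ 0, `h_{k+1;a}` is the
coefficient of 1/u in (u - a₁)⋯(u - a_k) H(u) (`factorialCoeff_succ`). Put ẽ_{k;a} = ω(h_{k;â})
(`eDual`). Since ω maps H(u) to E(u) = 1/H(-u) (`map_omega_seriesH`), the ẽ's are residues of E(u).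
Applied to H(u)E(-u) = 1 with one string of nodes a₀, a₋₁, …, the identity `residue_mul_inverse`
becomes an orthogonality relation between the h's and the ẽ's with exactly the shifts that the
determinants need (`sum_hMulti_mul_eDual`).

The orthogonality says that two unitriangular matrices are inverse to each other. The Jacobi–Trudi
determinant of μ is a minor of the first one, and by Jacobi's theorem it equals, up to sign, the
complementary minor of the second. The complementary index sets are the beta sets of μ and μ', and
the signs cancel, so `s_{μ;a}` = det[ẽ_{μ'_i-i+j; τ^{j-1}a}] (`multiSchur_eq_det_eDual`). For one
column this gives ẽ = e. The generating series and the Nägelsbach–Kostka formula follow at once, and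
so does duality, because ω carries the Jacobi–Trudi matrix entrywise to the dual one.

For a_i = i - 1/2 it remains to show that ψ maps `s_{μ;a}` to `s*_μ`. Multiplied by the denominator
alternant D, each entry ψ(h) becomes D with a new first column, and expansion along that column
factors the Jacobi–Trudi matrix. Its determinant is then the numerator of `s*_μ` times a factor K
independent of μ, and μ = ∅ determines K (`psiAt_multiSchur_halfSeq`).

Finally ψ is injective, so that the preimage of `s*_μ` is unique. On ℂ[p₁, …, p_n] it maps onto the
symmetric polynomials in the n variables x_i - i (`psiSymm_surjective`). These form a polynomial
ring in n generators, and a surjective endomorphism of a Noetherian ring is injective. -/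

namespace FrobeniusSchur

open scoped PowerSeries

noncomputable section

/-! ## Coefficients in inverse factorial powers as residues -/

section Residue

variable {A B : Type*} [CommRing A] [Algebra ℂ A] [CommRing B] [Algebra ℂ B]

/-- The coefficient of `u⁻¹` in `f(u) F(u)`, where `F` is a series in `t = 1/u`. -/
def residue (F : A⟦X⟧) : Polynomial ℂ →ₗ[ℂ] A :=
  Polynomial.lsum fun i => LinearMap.toSpanSingleton ℂ A (PowerSeries.coeff (i + 1) F)

theorem residue_X_pow (F : A⟦X⟧) (i : ℕ) :
    residue F (Polynomial.X ^ i) = PowerSeries.coeff (i + 1) F := by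
  rw [residue, Polynomial.lsum_apply, Polynomial.X_pow_eq_monomial,
    Polynomial.sum_monomial_index] <;> simp

/-- The polynomial `(u - a₁) ⋯ (u - a_k)`. -/
def factorialPower (a : ℤ → ℂ) (k : ℕ) : Polynomial ℂ :=
  ∏ i ∈ Finset.range k, (Polynomial.X - Polynomial.C (a (i + 1)))

theorem factorialPower_succ (a : ℤ → ℂ) (k : ℕ) : factorialPower a (k + 1) =
    factorialPower a k * (Polynomial.X - Polynomial.C (a (k + 1))) :=
  Finset.prod_range_succ _ _

/-- Compares coefficients in (u - a_{k+1}) · 1/((u - a₁)⋯(u - a_{k+1})) = 1/((u - a₁)⋯(u - a_k)). -/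
theorem coeff_invFactorialPower_succ (a : ℤ → ℂ) (n k : ℕ) :
    PowerSeries.coeff (n + 1) (invFactorialPower a (k + 1)) =
      PowerSeries.coeff n (invFactorialPower a k) +
        a (k + 1) * PowerSeries.coeff n (invFactorialPower a (k + 1)) := by
  have h : invFactorialPower a (k + 1) = PowerSeries.X * invFactorialPower a k +
      PowerSeries.C (a (k + 1)) * (PowerSeries.X * invFactorialPower a (k + 1)) := by
    have h1 := PowerSeries.inv_mul_cancel (1 - PowerSeries.C (a (k + 1)) * PowerSeries.X : ℂ⟦X⟧)
      (by simp)
    rw [invFactorialPower, invFactorialPower, Finset.prod_range_succ]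
    linear_combination (∏ i ∈ Finset.range k,
      (PowerSeries.X * (1 - PowerSeries.C (a (i + 1)) * PowerSeries.X)⁻¹)) * PowerSeries.X * h1
  conv_lhs => rw [h]
  simp [PowerSeries.coeff_succ_X_mul]

theorem coeff_invFactorialPower_of_lt (a : ℤ → ℂ) {n k : ℕ} (h : n < k) :
    PowerSeries.coeff n (invFactorialPower a k) = 0 := by
  rw [invFactorialPower, Finset.prod_mul_distrib, Finset.prod_const, Finset.card_range,
    PowerSeries.coeff_X_pow_mul', if_neg (by omega)]

theorem coeff_succ_invFactorialPower_zero (a : ℤ → ℂ) (n : ℕ) :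
    PowerSeries.coeff (n + 1) (invFactorialPower a 0) = 0 := by
  simp [invFactorialPower, PowerSeries.coeff_one]

/-- This is the coefficient of u^{-n-1} in 1/(u - v) = ∑_k (v - a₁)⋯(v - a_k) / ((u - a₁)⋯(u -
a_{k+1})). It makes the factorial powers and the inverse factorial powers dual bases for the residue
pairing. -/
theorem X_pow_eq_sum_factorialPower (a : ℤ → ℂ) (n : ℕ) : (Polynomial.X ^ n : Polynomial ℂ) =
    ∑ k ∈ Finset.range (n + 1),
      PowerSeries.coeff (n + 1) (invFactorialPower a (k + 1)) • factorialPower a k := by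
  induction n with
  | zero => simp [coeff_invFactorialPower_self, factorialPower]
  | succ n ih =>
    have hs : ∀ k, Polynomial.X * factorialPower a k =
        factorialPower a (k + 1) + a (k + 1) • factorialPower a k := by
      intro k
      rw [factorialPower_succ, Polynomial.smul_eq_C_mul]
      ring
    have h1 : ∀ k, PowerSeries.coeff (n + 1 + 1) (invFactorialPower a (k + 1)) •
        factorialPower a k = PowerSeries.coeff (n + 1) (invFactorialPower a k) •
        factorialPower a k + PowerSeries.coeff (n + 1) (invFactorialPower a (k + 1)) •
        (a (k + 1) • factorialPower a k) := by
      intro k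
      rw [coeff_invFactorialPower_succ, add_smul, smul_smul, mul_comm (a _)]
    -- The first half loses its k = 0 term and is reindexed, the second half loses its top term.
    -- Together they are X times the expansion of X ^ n.
    simp only [h1, Finset.sum_add_distrib]
    rw [Finset.sum_range_succ', coeff_succ_invFactorialPower_zero, zero_smul, add_zero,
      Finset.sum_range_succ (fun k => _ • a _ • _), coeff_invFactorialPower_of_lt a (by omega),
      zero_smul, add_zero, ← Finset.sum_add_distrib, pow_succ', ih, Finset.mul_sum]
    refine Finset.sum_congr rfl fun k _ => ?_
    rw [mul_smul_comm, hs, smul_add]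

theorem factorialCoeff_eq_of_factorialSeries_eq {a : ℤ → ℂ} {F : A⟦X⟧} {g : ℕ → A}
    (h : factorialSeries a g = F) : factorialCoeff a F = g :=
  (existsUnique_factorialSeries a F).unique (factorialSeries_factorialCoeff a F) h

/-- By uniqueness of the expansion it is enough that these residues, together with the constant
term, reproduce F. That is the residue of the expansion of u^n in factorial powers. -/
theorem factorialCoeff_succ (a : ℤ → ℂ) (F : A⟦X⟧) (k : ℕ) :
    factorialCoeff a F (k + 1) = residue F (factorialPower a k) := by
  have h : factorialSeries a (fun k => k.casesOn (PowerSeries.coeff 0 F)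
      fun k => residue F (factorialPower a k)) = F := by
    ext n
    rw [factorialSeries, PowerSeries.coeff_mk, Finset.sum_range_succ']
    cases n with
    | zero => simp [invFactorialPower]
    | succ n =>
      rw [coeff_succ_invFactorialPower_zero, zero_smul, add_zero, ← residue_X_pow,
        X_pow_eq_sum_factorialPower a n, map_sum]
      simp only [map_smul]
  rw [factorialCoeff_eq_of_factorialSeries_eq h]

theorem map_factorialSeries (f : A →ₐ[ℂ] B) (a : ℤ → ℂ) (g : ℕ → A) :
    PowerSeries.map (f : A →+* B) (factorialSeries a g) = factorialSeries a fun k => f (g k) := by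
  ext n
  simp [factorialSeries]

theorem map_factorialCoeff (f : A →ₐ[ℂ] B) (a : ℤ → ℂ) (F : A⟦X⟧) (k : ℕ) :
    f (factorialCoeff a F k) = factorialCoeff a (PowerSeries.map (f : A →+* B) F) k := by
  rw [factorialCoeff_eq_of_factorialSeries_eq (g := fun k => f (factorialCoeff a F k))]
  rw [← map_factorialSeries, factorialSeries_factorialCoeff]

/-- If `F G = 1`, then the residues of `F` and `G` at `∏ (u - c_i)` are related by the divided
differences of this product. -/
theorem residue_mul_inverse (F G : A⟦X⟧) (hF : PowerSeries.constantCoeff F = 1)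
    (hG : PowerSeries.constantCoeff G = 1) (hFG : F * G = 1) (c : ℕ → ℂ) (M m : ℕ) :
    residue F ((∏ i ∈ Finset.range M, (Polynomial.X - Polynomial.C (c i))) * Polynomial.X ^ m) +
    residue G ((∏ i ∈ Finset.range M, (Polynomial.X - Polynomial.C (c i))) * Polynomial.X ^ m) +
    ∑ k ∈ Finset.range M,
      residue F (∏ i ∈ Finset.range k, (Polynomial.X - Polynomial.C (c i))) *
      residue G ((∏ i ∈ Finset.Ico (k + 1) M, (Polynomial.X - Polynomial.C (c i))) *
        Polynomial.X ^ m) +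
    ∑ i ∈ Finset.range m,
      residue F ((∏ i ∈ Finset.range M, (Polynomial.X - Polynomial.C (c i))) * Polynomial.X ^ i) *
      residue G (Polynomial.X ^ (m - 1 - i)) = 0 := by
  induction M generalizing m with
  | zero =>
    -- Without nodes the claim is the coefficient of t^{m+1} in FG = 1. The two end terms contain
    -- the constant terms, which are 1.
    have h := congrArg (PowerSeries.coeff (m + 1)) hFG
    rw [PowerSeries.coeff_mul, Finset.Nat.sum_antidiagonal_eq_sum_range_succ_mk,
      Finset.sum_range_succ', Finset.sum_range_succ] at h
    simp only [PowerSeries.coeff_one, Nat.succ_ne_zero, if_false, Nat.sub_self, Nat.sub_zero,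
      PowerSeries.coeff_zero_eq_constantCoeff_apply, hF, hG] at h
    simp only [Finset.range_zero, Finset.prod_empty, one_mul, Finset.sum_empty, residue_X_pow]
    have h2 : ∀ i ∈ Finset.range m, PowerSeries.coeff (i + 1) F *
        PowerSeries.coeff (m - 1 - i + 1) G =
        PowerSeries.coeff (i + 1) F * PowerSeries.coeff (m + 1 - (i + 1)) G := by
      intro i hi
      have := Finset.mem_range.1 hi
      rw [show m - 1 - i + 1 = m + 1 - (i + 1) by omega]
    rw [Finset.sum_congr rfl h2]
    linear_combination h
  | succ M ih =>
    have hmul : ∀ (p : Polynomial ℂ) (m : ℕ), p * (Polynomial.X - Polynomial.C (c M)) *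
        Polynomial.X ^ m = p * Polynomial.X ^ (m + 1) - c M • (p * Polynomial.X ^ m) := by
      intro p m
      rw [Polynomial.smul_eq_C_mul]
      ring
    -- The auxiliary power X ^ m serves the induction: a new factor X - c_M turns the claim for m
    -- into the one for m + 1 minus c_M times the one for m. The i = 0 term of the last sum in the
    -- case m + 1 supplies the new summand k = M.
    have h0 := ih m
    have h1 := ih (m + 1)
    rw [Finset.sum_range_succ _ M]
    have hI : ∀ k ∈ Finset.range M,
        residue F (∏ i ∈ Finset.range k, (Polynomial.X - Polynomial.C (c i))) *
        residue G ((∏ i ∈ Finset.Ico (k + 1) (M + 1), (Polynomial.X - Polynomial.C (c i))) *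
          Polynomial.X ^ m) =
        residue F (∏ i ∈ Finset.range k, (Polynomial.X - Polynomial.C (c i))) *
        residue G ((∏ i ∈ Finset.Ico (k + 1) M, (Polynomial.X - Polynomial.C (c i))) *
          Polynomial.X ^ (m + 1)) - c M •
        (residue F (∏ i ∈ Finset.range k, (Polynomial.X - Polynomial.C (c i))) *
        residue G ((∏ i ∈ Finset.Ico (k + 1) M, (Polynomial.X - Polynomial.C (c i))) *
          Polynomial.X ^ m)) := by
      intro k hk
      have := Finset.mem_range.1 hk
      rw [Finset.prod_Ico_succ_top (by omega), hmul, map_sub, map_smul, mul_sub, mul_smul_comm]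
    rw [Finset.sum_congr rfl hI, Finset.sum_sub_distrib, ← Finset.smul_sum]
    simp only [Finset.prod_range_succ _ M, hmul, Finset.Ico_self, Finset.prod_empty, one_mul,
      map_sub, map_smul, sub_mul, Finset.sum_sub_distrib, smul_mul_assoc, ← Finset.smul_sum]
    rw [Finset.sum_range_succ'] at h1
    simp only [Nat.add_sub_cancel, pow_zero, mul_one, Nat.sub_zero] at h1
    have hJ : ∀ i ∈ Finset.range m,
        residue F ((∏ i ∈ Finset.range M, (Polynomial.X - Polynomial.C (c i))) *
          Polynomial.X ^ (i + 1)) * residue G (Polynomial.X ^ (m - (i + 1))) =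
        residue F ((∏ i ∈ Finset.range M, (Polynomial.X - Polynomial.C (c i))) *
          Polynomial.X ^ (i + 1)) * residue G (Polynomial.X ^ (m - 1 - i)) := by
      intro i _
      rw [show m - (i + 1) = m - 1 - i by omega]
    rw [Finset.sum_congr rfl hJ] at h1
    have h2 := congrArg (fun x => c M • x) h0
    simp only [smul_add, smul_zero] at h2
    linear_combination h1 - h2

end Residue

/-! ## The functions `h_{k;a}` and their images under `ω` -/

theorem dualSeq_dualSeq (a : ℤ → ℂ) : dualSeq (dualSeq a) = a := by
  funext i
  simp [dualSeq]

theorem dualSeq_tau (r : ℤ) (a : ℤ → ℂ) : dualSeq (tau r a) = tau (-r) (dualSeq a) := by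
  funext i
  simp only [dualSeq, tau]
  congr 2
  ring

theorem tau_tau (r s : ℤ) (a : ℤ → ℂ) : tau r (tau s a) = tau (r + s) a := by
  funext i
  simp only [tau, add_assoc]

theorem tau_zero (a : ℤ → ℂ) : tau 0 a = a := by
  funext i
  simp [tau]

theorem hMulti_of_neg {k : ℤ} (hk : k < 0) (a : ℤ → ℂ) : hMulti k a = 0 := by
  rw [hMulti, if_neg (by omega)]

theorem hMulti_zero (a : ℤ → ℂ) : hMulti 0 a = 1 := by
  simp [hMulti, factorialCoeff_seriesH_zero]

theorem hMulti_natCast (k : ℕ) (a : ℤ → ℂ) : hMulti k a = factorialCoeff a seriesH k := by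
  simp [hMulti]

theorem hMulti_succ (k : ℕ) (a : ℤ → ℂ) :
    hMulti ((k : ℤ) + 1) a = residue seriesH (factorialPower a k) := by
  rw [← factorialCoeff_succ, ← hMulti_natCast]
  push_cast
  rfl

theorem factorialPower_tau_neg_one (a : ℤ → ℂ) (k : ℕ) : factorialPower (tau (-1) a) (k + 1) =
    (Polynomial.X - Polynomial.C (a 0)) * factorialPower a k := by
  rw [factorialPower, factorialPower, Finset.prod_range_succ', mul_comm]
  simp [tau]

/-- The shift replaces the last factor u - a_{k-1} of the factorial power by u - a₀, which changes
it by a scalar multiple of the shorter power. -/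
theorem hMulti_tau_neg_one (k : ℤ) (a : ℤ → ℂ) : hMulti k (tau (-1) a) =
    hMulti k a + (a (k - 1) - a 0) • hMulti (k - 1) a := by
  rcases lt_trichotomy k 0 with hk | rfl | hk
  · rw [hMulti_of_neg hk, hMulti_of_neg hk, hMulti_of_neg (by omega), smul_zero, add_zero]
  · rw [hMulti_zero, hMulti_zero, hMulti_of_neg (by omega), smul_zero, add_zero]
  · obtain ⟨k, rfl⟩ : ∃ m : ℕ, k = m + 1 := ⟨(k - 1).toNat, by omega⟩
    rw [hMulti_succ, hMulti_succ]
    cases k with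
    | zero => simp [factorialPower]
    | succ k =>
      rw [factorialPower_tau_neg_one, factorialPower_succ]
      push_cast
      rw [add_sub_cancel_right, hMulti_succ, ← map_smul, ← map_add, Polynomial.smul_eq_C_mul]
      congr 1
      rw [map_sub]
      ring

/-! ### Newton's relation and the action of ω on generating series -/

theorem derivative_seriesH : PowerSeries.derivative SymFun seriesH =
    seriesH * PowerSeries.derivative SymFun powerSumSeries := by
  rw [seriesH, PowerSeries.derivative_subst
    (PowerSeries.HasSubst.of_constantCoeff_zero' constantCoeff_powerSumSeries),
    PowerSeries.derivative_exp]

theorem coeff_derivative_powerSumSeries (n : ℕ) :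
    PowerSeries.coeff n (PowerSeries.derivative SymFun powerSumSeries) = psum n := by
  have hk : (n + 1 : ℂ) ≠ 0 := by exact_mod_cast n.succ_ne_zero
  rw [PowerSeries.coeff_derivative, powerSumSeries, PowerSeries.coeff_mk]
  have : ((n : SymFun) + 1) = algebraMap ℂ SymFun (n + 1) := by simp
  rw [this, mul_comm, ← Algebra.smul_def, smul_smul, mul_inv_cancel₀ hk, one_smul]

/-- The Newton relation between the `h_k` and the power sums. -/
theorem newton_seriesH (n : ℕ) : PowerSeries.coeff (n + 1) seriesH * (n + 1) =
    ∑ p ∈ Finset.HasAntidiagonal.antidiagonal n, PowerSeries.coeff p.1 seriesH * psum p.2 := by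
  have h := congrArg (PowerSeries.coeff n) derivative_seriesH
  rw [PowerSeries.coeff_derivative, PowerSeries.coeff_mul] at h
  simpa only [coeff_derivative_powerSumSeries] using h

/-- With P' = ∑ p_{n+1} t^n, applying ω to P' is the same as t ↦ -t. Hence ω(H) and H(-u) have
opposite logarithmic derivatives, and their product is constant. -/
theorem map_omega_seriesH :
    PowerSeries.map ((omega : SymFun →ₐ[ℂ] SymFun) : SymFun →+* SymFun) seriesH = seriesE := by
  set W := PowerSeries.map ((omega : SymFun →ₐ[ℂ] SymFun) : SymFun →+* SymFun) seriesH with hW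
  set N := PowerSeries.evalNegHom seriesH with hN
  set Q := PowerSeries.evalNegHom (PowerSeries.derivative SymFun powerSumSeries) with hQ
  have hdW : PowerSeries.derivative SymFun W = W * Q := by
    have h := congrArg
      (PowerSeries.map ((omega : SymFun →ₐ[ℂ] SymFun) : SymFun →+* SymFun)) derivative_seriesH
    rw [map_mul] at h
    convert h using 1
    · ext1 n
      simp [PowerSeries.coeff_derivative, hW]
    · congr 1
      ext1 n
      rw [hQ, PowerSeries.evalNegHom, PowerSeries.coeff_rescale, PowerSeries.coeff_map,
        coeff_derivative_powerSumSeries]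
      change _ = omegaHom (psum n)
      rw [psum, omegaHom, MvPolynomial.aeval_X, psum]
  have hdN : PowerSeries.derivative SymFun N = -(N * Q) := by
    have h := congrArg PowerSeries.evalNegHom derivative_seriesH
    rw [map_mul] at h
    rw [hN, hQ, ← h]
    ext1 n
    simp only [PowerSeries.evalNegHom, PowerSeries.coeff_rescale, PowerSeries.coeff_derivative,
      map_neg]
    ring
  have hcN : PowerSeries.constantCoeff N = 1 := by
    rw [hN, ← PowerSeries.coeff_zero_eq_constantCoeff_apply, PowerSeries.evalNegHom,
      PowerSeries.coeff_rescale]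
    simp [constantCoeff_seriesH]
  have hWN : W * N = 1 := by
    refine PowerSeries.derivative.ext ?_ ?_
    · rw [Derivation.leibniz, hdW, hdN]
      simp only [smul_eq_mul, PowerSeries.derivative_one]
      ring
    · rw [map_mul, hcN, hW, ← PowerSeries.coeff_zero_eq_constantCoeff_apply,
        PowerSeries.coeff_map, PowerSeries.coeff_zero_eq_constantCoeff_apply,
        constantCoeff_seriesH]
      simp
  have hE : N * seriesE = 1 := PowerSeries.mul_invOfUnit _ 1 (by simpa using hcN)
  linear_combination seriesE * hWN - W * hE

theorem constantCoeff_seriesE : PowerSeries.constantCoeff seriesE = 1 := by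
  rw [← map_omega_seriesH, ← PowerSeries.coeff_zero_eq_constantCoeff_apply,
    PowerSeries.coeff_map, PowerSeries.coeff_zero_eq_constantCoeff_apply, constantCoeff_seriesH]
  simp

/-- The function `ω(h_{k;â})`, which turns out to be `e_{k;a}`. -/
def eDual (k : ℤ) (a : ℤ → ℂ) : SymFun := omega (hMulti k (dualSeq a))

theorem omega_hMulti (k : ℤ) (a : ℤ → ℂ) : omega (hMulti k a) = eDual k (dualSeq a) := by
  rw [eDual, dualSeq_dualSeq]

theorem eDual_of_neg {k : ℤ} (hk : k < 0) (a : ℤ → ℂ) : eDual k a = 0 := by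
  rw [eDual, hMulti_of_neg hk, map_zero]

theorem eDual_zero (a : ℤ → ℂ) : eDual 0 a = 1 := by
  rw [eDual, hMulti_zero, map_one]

theorem eDual_natCast (k : ℕ) (a : ℤ → ℂ) :
    eDual k a = factorialCoeff (dualSeq a) seriesE k := by
  rw [eDual, hMulti_natCast, ← map_omega_seriesH]
  exact map_factorialCoeff (omega : SymFun →ₐ[ℂ] SymFun) _ _ _

/-- The sign is that of du under u ↦ -u. -/
theorem residue_evalNegHom (F : SymFun⟦X⟧) (f : Polynomial ℂ) :
    residue (PowerSeries.evalNegHom F) f = - residue F (f.comp (-Polynomial.X)) := by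
  induction f using Polynomial.induction_on' with
  | add p q hp hq => rw [Polynomial.add_comp, map_add, map_add, hp, hq, neg_add]
  | monomial n c =>
    rw [← Polynomial.C_mul_X_pow_eq_monomial, Polynomial.mul_comp, Polynomial.C_comp,
      Polynomial.X_pow_comp, ← Polynomial.smul_eq_C_mul, ← Polynomial.smul_eq_C_mul, map_smul,
      map_smul, residue_X_pow, PowerSeries.evalNegHom, PowerSeries.coeff_rescale]
    have h : (-Polynomial.X : Polynomial ℂ) ^ n = (-1 : ℂ) ^ n • Polynomial.X ^ n := by
      rw [neg_pow, Polynomial.smul_eq_C_mul]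
      simp
    rw [h, map_smul, residue_X_pow, ← smul_neg]
    congr 1
    rw [pow_succ, Algebra.smul_def]
    simp

/-- Negating the nodes a₀, a₋₁, …, a_{1-k} gives â₁, …, â_k. Of the k + 1 signs, k come from the
linear factors and one from the residue. -/
theorem residue_seriesE_neg (a : ℤ → ℂ) (k : ℕ) :
    residue (PowerSeries.evalNegHom seriesE)
      (∏ i ∈ Finset.range k, (Polynomial.X - Polynomial.C (a (-(i : ℤ))))) =
    (-1) ^ (k + 1) * eDual ((k : ℤ) + 1) a := by
  have h : (∏ i ∈ Finset.range k, (Polynomial.X - Polynomial.C (a (-(i : ℤ))))).comp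
      (-Polynomial.X) = (-1 : ℂ) ^ k • factorialPower (dualSeq a) k := by
    rw [Polynomial.prod_comp, factorialPower, Polynomial.smul_eq_C_mul, map_pow, map_neg, map_one]
    conv_rhs => rw [← Finset.card_range k, ← Finset.prod_const, Finset.card_range]
    rw [← Finset.prod_mul_distrib]
    refine Finset.prod_congr rfl fun i _ => ?_
    have : (1 : ℤ) - (i + 1) = -i := by ring
    rw [dualSeq, this]
    simp
    ring
  have h2 := eDual_natCast (k + 1) a
  push_cast at h2
  rw [residue_evalNegHom, h, map_smul, ← factorialCoeff_succ, h2, Algebra.smul_def, map_pow,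
    map_neg, map_one, pow_succ]
  ring

/-- This is `residue_mul_inverse` for H(u)E(-u) = 1 with d - 1 nodes a₀, a₋₁, …. An initial segment
of nodes gives an h, the final segment left after dropping one node gives an e, and the different
shifts of a record where the string is cut. The two residues standing alone are the summands k = d
and k = 0. -/
theorem sum_hMulti_mul_eDual (a : ℤ → ℂ) (d : ℕ) :
    ∑ k ∈ Finset.range (d + 1), hMulti k (tau (1 - k) a) *
      ((-1) ^ (d - k) * eDual ((d : ℤ) - k) (tau (-k) a)) = if d = 0 then 1 else 0 := by
  cases d with
  | zero => simp [hMulti_zero, eDual_zero]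
  | succ M =>
    have hG : PowerSeries.constantCoeff (PowerSeries.evalNegHom seriesE) = 1 := by
      rw [← PowerSeries.coeff_zero_eq_constantCoeff_apply, PowerSeries.evalNegHom,
        PowerSeries.coeff_rescale]
      simp [constantCoeff_seriesE]
    have h := residue_mul_inverse seriesH (PowerSeries.evalNegHom seriesE) constantCoeff_seriesH
      hG seriesH_mul_seriesE_neg (fun i => a (-(i : ℤ))) M 0
    have hF : ∀ k, residue seriesH
        (∏ i ∈ Finset.range k, (Polynomial.X - Polynomial.C (a (-(i : ℤ))))) =
        hMulti ((k : ℤ) + 1) (tau (1 - ((k : ℤ) + 1)) a) := by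
      intro k
      rw [hMulti_succ, factorialPower, ← Finset.prod_range_reflect]
      congr 1
      refine Finset.prod_congr rfl fun i hi => ?_
      have := Finset.mem_range.1 hi
      rw [tau]
      congr 3
      omega
    have hE : ∀ k ∈ Finset.range M, residue (PowerSeries.evalNegHom seriesE)
        (∏ i ∈ Finset.Ico (k + 1) M, (Polynomial.X - Polynomial.C (a (-(i : ℤ))))) =
        (-1) ^ (M - k) * eDual ((M : ℤ) - k) (tau (-((k : ℤ) + 1)) a) := by
      intro k hk
      have := Finset.mem_range.1 hk
      have h1 := residue_seriesE_neg (tau (-((k : ℤ) + 1)) a) (M - (k + 1))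
      rw [show M - (k + 1) + 1 = M - k by omega,
        show ((M - (k + 1) : ℕ) : ℤ) + 1 = (M : ℤ) - k by omega] at h1
      rw [← h1, Finset.prod_Ico_eq_prod_range]
      congr 1
      refine Finset.prod_congr rfl fun i hi => ?_
      rw [tau]
      congr 3
      push_cast
      ring
    simp only [pow_zero, mul_one, Finset.range_zero, Finset.sum_empty, add_zero] at h
    rw [hF, residue_seriesE_neg, Finset.sum_congr rfl fun k hk => by rw [hF, hE k hk]] at h
    rw [Finset.sum_range_succ, Finset.sum_range_succ']
    rw [if_neg (by omega)]
    push_cast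
    simp only [sub_self, Nat.sub_self, pow_zero, one_mul, hMulti_zero, eDual_zero, sub_zero,
      neg_zero, tau_zero, add_sub_add_right_eq_sub, mul_one]
    linear_combination h

/-! ## Complementary minors and the dual Jacobi–Trudi formula -/

/-- Jacobi's formula for complementary minors of inverse matrices. -/
theorem det_complementary_minor {R : Type*} [CommRing R] {m n : ℕ}
    (A B : Matrix (Fin (m + n)) (Fin (m + n)) R) (hAB : A * B = 1) (hA : A.det = 1)
    (σ : Equiv.Perm (Fin (m + n))) :
    (Matrix.of fun i j : Fin n => A (σ (Fin.natAdd m i)) (Fin.natAdd m j)).det =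
    ((Equiv.Perm.sign σ : ℤ) : R) *
      (Matrix.of fun i j : Fin m => B (Fin.castAdd n i) (σ (Fin.castAdd n j))).det := by
  set e : Fin m ⊕ Fin n ≃ Fin (m + n) := finSumFinEquiv with he
  set A' := (A.submatrix σ id).submatrix e e with hA'
  set B' := (B.submatrix id σ).submatrix e e with hB'
  have hdet : A'.det = ((Equiv.Perm.sign σ : ℤ) : R) := by
    rw [hA', Matrix.det_submatrix_equiv_self, Matrix.det_permute, hA, mul_one]
  have hmul : A' * B' = 1 := by
    rw [hA', hB', Matrix.submatrix_mul_equiv, ← Matrix.submatrix_mul _ _ _ _ _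
      Function.bijective_id, hAB, Matrix.submatrix_one_equiv, Matrix.submatrix_one_equiv]
  rw [← Matrix.fromBlocks_toBlocks A', ← Matrix.fromBlocks_toBlocks B',
    Matrix.fromBlocks_multiply, ← Matrix.fromBlocks_one, Matrix.fromBlocks_inj] at hmul
  obtain ⟨h11, -, h21, -⟩ := hmul
  -- Only the first block column of A'B' = 1 is used. Determinants give det A' · det B'₁₁ = det
  -- A'₂₂.
  have h : A' * Matrix.fromBlocks B'.toBlocks₁₁ 0 B'.toBlocks₂₁ 1 =
      Matrix.fromBlocks 1 A'.toBlocks₁₂ 0 A'.toBlocks₂₂ := by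
    conv_lhs => rw [← Matrix.fromBlocks_toBlocks A', Matrix.fromBlocks_multiply, h11, h21]
    simp
  have h2 := congrArg Matrix.det h
  rw [Matrix.det_mul, Matrix.det_fromBlocks_zero₁₂, Matrix.det_fromBlocks_zero₂₁, hdet,
    Matrix.det_one, Matrix.det_one, mul_one, one_mul] at h2
  have h22 : A'.toBlocks₂₂ =
      Matrix.of fun i j : Fin n => A (σ (Fin.natAdd m i)) (Fin.natAdd m j) := by
    ext i j
    simp [A', he, Matrix.toBlocks₂₂]
  have hB11 : B'.toBlocks₁₁ =
      Matrix.of fun i j : Fin m => B (Fin.castAdd n i) (σ (Fin.castAdd n j)) := by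
    ext i j
    simp [B', he, Matrix.toBlocks₁₁]
  rw [← h22, ← hB11, h2]

/-! ### Beta sets of a diagram and the sign of their permutation -/

theorem lt_rowLen_iff_lt_colLen (μ : YoungDiagram) (i j : ℕ) :
    j < μ.rowLen i ↔ i < μ.colLen j :=
  YoungDiagram.mem_iff_lt_rowLen.symm.trans YoungDiagram.mem_iff_lt_colLen

/-- The complementary beta sets of a diagram `μ` in an `n × m` rectangle: the first `m` values are
`m - 1 - j + μ'_j` (in increasing order), the other ones are `m + i - μ_i`. -/
def betaFun (μ : YoungDiagram) (m n : ℕ) (hn : μ.colLen 0 ≤ n) (i : Fin (m + n)) : Fin (m + n) :=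
  Fin.addCases (fun j : Fin m => ⟨j + μ.colLen (j.rev : ℕ), by
      have := μ.colLen_anti 0 (j.rev : ℕ) (Nat.zero_le _); omega⟩)
    (fun i : Fin n => ⟨m + i - μ.rowLen i, by omega⟩) i

theorem betaFun_castAdd (μ : YoungDiagram) (m n : ℕ) (hn : μ.colLen 0 ≤ n) (j : Fin m) :
    (betaFun μ m n hn (Fin.castAdd n j) : ℕ) = j + μ.colLen (j.rev : ℕ) := by
  rw [betaFun, Fin.addCases_left]

theorem betaFun_natAdd (μ : YoungDiagram) (m n : ℕ) (hn : μ.colLen 0 ≤ n) (i : Fin n) :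
    (betaFun μ m n hn (Fin.natAdd m i) : ℕ) = m + i - μ.rowLen i := by
  rw [betaFun, Fin.addCases_right]

theorem betaFun_castAdd_lt (μ : YoungDiagram) (m n : ℕ) (hn : μ.colLen 0 ≤ n) {j j' : Fin m}
    (h : j < j') : betaFun μ m n hn (Fin.castAdd n j) < betaFun μ m n hn (Fin.castAdd n j') := by
  rw [Fin.lt_def, betaFun_castAdd, betaFun_castAdd]
  have h1 : (j'.rev : ℕ) ≤ j.rev := Fin.rev_le_rev.2 h.le
  have h2 := μ.colLen_anti _ _ h1
  have h3 : (j : ℕ) < j' := h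
  omega

theorem betaFun_natAdd_lt (μ : YoungDiagram) (m n : ℕ) (hn : μ.colLen 0 ≤ n)
    (hm : μ.rowLen 0 ≤ m) {i i' : Fin n} (h : i < i') :
    betaFun μ m n hn (Fin.natAdd m i) < betaFun μ m n hn (Fin.natAdd m i') := by
  rw [Fin.lt_def, betaFun_natAdd, betaFun_natAdd]
  have h1 := μ.rowLen_anti 0 i (Nat.zero_le _)
  have h2 := μ.rowLen_anti i i' h.le
  have h3 : (i : ℕ) < i' := h
  omega

/-- The two values are compared by asking whether the box in row i and column m - 1 - j lies in μ.
So the inversions between the two blocks are the boxes of μ. -/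
theorem betaFun_castAdd_lt_natAdd (μ : YoungDiagram) (m n : ℕ) (hn : μ.colLen 0 ≤ n)
    (hm : μ.rowLen 0 ≤ m) (j : Fin m) (i : Fin n) :
    betaFun μ m n hn (Fin.castAdd n j) < betaFun μ m n hn (Fin.natAdd m i) ↔
      ¬ (i : ℕ) < μ.colLen (j.rev : ℕ) := by
  rw [Fin.lt_def, betaFun_castAdd, betaFun_natAdd]
  have h1 := μ.rowLen_anti 0 i (Nat.zero_le _)
  have h2 := lt_rowLen_iff_lt_colLen μ i (j.rev : ℕ)
  have h3 := Fin.val_rev j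
  omega

theorem betaFun_castAdd_ne_natAdd (μ : YoungDiagram) (m n : ℕ) (hn : μ.colLen 0 ≤ n)
    (hm : μ.rowLen 0 ≤ m) (j : Fin m) (i : Fin n) :
    betaFun μ m n hn (Fin.castAdd n j) ≠ betaFun μ m n hn (Fin.natAdd m i) := by
  rw [Ne, Fin.ext_iff, betaFun_castAdd, betaFun_natAdd]
  have h1 := μ.rowLen_anti 0 i (Nat.zero_le _)
  have h2 := lt_rowLen_iff_lt_colLen μ i (j.rev : ℕ)
  have h3 := Fin.val_rev j
  omega

theorem betaFun_injective (μ : YoungDiagram) (m n : ℕ) (hn : μ.colLen 0 ≤ n)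
    (hm : μ.rowLen 0 ≤ m) : Function.Injective (betaFun μ m n hn) := by
  intro i j
  refine Fin.addCases (fun i => ?_) (fun i => ?_) i <;>
  refine Fin.addCases (fun j => ?_) (fun j => ?_) j <;> intro h
  · have h1 : StrictMono fun j => betaFun μ m n hn (Fin.castAdd n j) :=
      fun _ _ => betaFun_castAdd_lt μ m n hn
    rw [h1.injective h]
  · exact absurd h (betaFun_castAdd_ne_natAdd μ m n hn hm _ _)
  · exact absurd h.symm (betaFun_castAdd_ne_natAdd μ m n hn hm _ _)
  · have h1 : StrictMono fun j => betaFun μ m n hn (Fin.natAdd m j) :=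
      fun _ _ => betaFun_natAdd_lt μ m n hn hm
    rw [h1.injective h]

/-- The complementary beta sets as a permutation. -/
def betaPerm (μ : YoungDiagram) (m n : ℕ) (hn : μ.colLen 0 ≤ n) (hm : μ.rowLen 0 ≤ m) :
    Equiv.Perm (Fin (m + n)) :=
  Equiv.ofBijective _ (Finite.injective_iff_bijective.1 (betaFun_injective μ m n hn hm))

/-- Both blocks are increasing, so every inversion is a box of μ, and the sign is (-1)^{|μ|},
written column by column. -/
theorem sign_betaPerm (μ : YoungDiagram) (m n : ℕ) (hn : μ.colLen 0 ≤ n)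
    (hm : μ.rowLen 0 ≤ m) :
    Equiv.Perm.sign (betaPerm μ m n hn hm) = ∏ j : Fin m, (-1) ^ μ.colLen j := by
  have hfilter : ∀ j : Fin (m + n), (∏ i < j, if betaPerm μ m n hn hm i < betaPerm μ m n hn hm j
      then (1 : ℤˣ) else -1) =
      ∏ i, if i < j ∧ ¬ betaFun μ m n hn i < betaFun μ m n hn j then -1 else 1 := by
    intro j
    rw [← Finset.filter_gt_eq_Iio, Finset.prod_filter]
    refine Finset.prod_congr rfl fun i _ => ?_
    change (if i < j then (if betaFun μ m n hn i < betaFun μ m n hn j then 1 else -1) else 1) = _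
    split_ifs <;> simp_all
  rw [Equiv.Perm.sign_eq_prod_prod_Iio]
  simp only [hfilter]
  rw [Fin.prod_univ_add]
  have h1 : ∀ j : Fin m, (∏ i : Fin (m + n), if i < Fin.castAdd n j ∧
      ¬ betaFun μ m n hn i < betaFun μ m n hn (Fin.castAdd n j) then (-1 : ℤˣ) else 1) = 1 := by
    intro j
    refine Finset.prod_eq_one fun i _ => if_neg ?_
    refine Fin.addCases (fun i => ?_) (fun i => ?_) i
    · rintro ⟨h, h'⟩
      exact h' (betaFun_castAdd_lt μ m n hn h)
    · rintro ⟨h, -⟩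
      rw [Fin.lt_def, Fin.val_natAdd, Fin.val_castAdd] at h
      omega
  have h2 : ∀ j : Fin n, (∏ i : Fin (m + n), if i < Fin.natAdd m j ∧
      ¬ betaFun μ m n hn i < betaFun μ m n hn (Fin.natAdd m j) then (-1 : ℤˣ) else 1) =
      ∏ i : Fin m, if (j : ℕ) < μ.colLen (i.rev : ℕ) then -1 else 1 := by
    intro j
    rw [Fin.prod_univ_add, Finset.prod_eq_one (s := (Finset.univ : Finset (Fin n))), mul_one]
    · refine Finset.prod_congr rfl fun i _ => ?_
      have h3 : Fin.castAdd n i < Fin.natAdd m j := by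
        rw [Fin.lt_def, Fin.val_natAdd, Fin.val_castAdd]
        omega
      simp only [h3, true_and, betaFun_castAdd_lt_natAdd μ m n hn hm, not_not]
    · intro i _
      refine if_neg ?_
      rintro ⟨h, h'⟩
      refine h' (betaFun_natAdd_lt μ m n hn hm ?_)
      rw [Fin.lt_def, Fin.val_natAdd, Fin.val_natAdd] at h
      exact Fin.lt_def.2 (by omega)
  simp only [h1, h2, Finset.prod_const_one, one_mul]
  rw [Finset.prod_comm, ← Equiv.prod_comp Fin.revPerm]
  refine Finset.prod_congr rfl fun j _ => ?_
  rw [Fin.revPerm_apply, Fin.rev_rev, Finset.prod_ite, Finset.prod_const, Finset.prod_const_one,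
    mul_one]
  congr 1
  have h := μ.colLen_anti 0 j (Nat.zero_le _)
  rw [Fin.card_filter_val_lt]
  omega

/-- The matrix with the entries `h_{q-p;τ^{s-q} a}`. -/
def hMatrix (a : ℤ → ℂ) (s : ℤ) (N : ℕ) : Matrix (Fin N) (Fin N) SymFun :=
  Matrix.of fun p q => hMulti ((q : ℤ) - p) (tau (s - q) a)

/-- The matrix with the entries `(-1)^{q-p} e_{q-p;τ^{s-1-p} a}`. -/
def eMatrix (a : ℤ → ℂ) (s : ℤ) (N : ℕ) : Matrix (Fin N) (Fin N) SymFun :=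
  Matrix.of fun p q => (-1) ^ (p + q : ℕ) * eDual ((q : ℤ) - p) (tau (s - 1 - p) a)

/-- For p ≤ r only p ≤ q ≤ r contributes, and q = p + k turns the entry into the orthogonality
relation of degree r - p for the sequence τ^{s-1-p} a. -/
theorem hMatrix_mul_eMatrix (a : ℤ → ℂ) (s : ℤ) (N : ℕ) : hMatrix a s N * eMatrix a s N = 1 := by
  ext1 p r
  rw [Matrix.mul_apply, Matrix.one_apply]
  simp only [hMatrix, eMatrix, Matrix.of_apply]
  rw [Fin.sum_univ_eq_sum_range fun q : ℕ => hMulti ((q : ℤ) - p) (tau (s - q) a) *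
    ((-1) ^ (q + r : ℕ) * eDual ((r : ℤ) - q) (tau (s - 1 - q) a))]
  by_cases hpr : (p : ℕ) ≤ r
  · rw [← Finset.sum_subset (s₁ := Finset.Ico (p : ℕ) (r + 1))]
    · have h := sum_hMulti_mul_eDual (tau (s - 1 - p) a) (r - p)
      rw [Finset.sum_Ico_eq_sum_range, show (r : ℕ) + 1 - p = r - p + 1 by omega]
      have h2 : (if p = r then (1 : SymFun) else 0) = if (r : ℕ) - p = 0 then 1 else 0 := by
        refine if_congr ?_ rfl rfl
        rw [Fin.ext_iff]
        omega
      rw [h2, ← h]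
      refine Finset.sum_congr rfl fun k hk => ?_
      have := Finset.mem_range.1 hk
      rw [tau_tau, tau_tau]
      congr 1
      · exact congrArg₂ hMulti (by omega) (congrArg (tau · a) (by omega))
      · congr 1
        · rw [show (p : ℕ) + k + r = (r - p - k) + 2 * (p + k) by omega, pow_add, pow_mul]
          simp
        · exact congrArg₂ eDual (by omega) (congrArg (tau · a) (by omega))
    · intro i hi
      have := Finset.mem_Ico.1 hi
      exact Finset.mem_range.2 (by omega)
    · intro i _ hi
      rw [Finset.mem_Ico] at hi
      by_cases h : (i : ℕ) < p
      · rw [hMulti_of_neg (by omega), zero_mul]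
      · rw [eDual_of_neg (by omega), mul_zero, mul_zero]
  · rw [if_neg (fun h => hpr (by rw [h]))]
    refine Finset.sum_eq_zero fun i _ => ?_
    by_cases h : (i : ℕ) < p
    · rw [hMulti_of_neg (by omega), zero_mul]
    · rw [eDual_of_neg (by omega), mul_zero, mul_zero]

theorem det_hMatrix (a : ℤ → ℂ) (s : ℤ) (N : ℕ) : (hMatrix a s N).det = 1 := by
  rw [Matrix.det_of_isUpperTriangular]
  · refine Finset.prod_eq_one fun i _ => ?_
    rw [hMatrix, Matrix.of_apply, sub_self, hMulti_zero]
  · intro p q h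
    have : (q : ℕ) < p := h
    exact hMulti_of_neg (by omega) _

/-- The dual Jacobi–Trudi formula. -/
theorem multiSchur_eq_det_eDual (μ : YoungDiagram) (a : ℤ → ℂ) (m : ℕ) (hm : μ.rowLen 0 ≤ m) :
    multiSchur μ a = Matrix.det (Matrix.of fun i j : Fin m =>
      eDual ((μ.colLen i : ℤ) - (i : ℕ) + (j : ℕ)) (tau (j : ℕ) a)) := by
  set n := μ.colLen 0 with hn
  -- The choice s = m makes column m + j of the first matrix carry the shift τ^{-j}, and row m - 1 -
  -- j of the second carry τ^j.
  have h := det_complementary_minor (hMatrix a m (m + n)) (eMatrix a m (m + n))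
    (hMatrix_mul_eMatrix a m _) (det_hMatrix a m _) (betaPerm μ m n le_rfl hm)
  rw [sign_betaPerm] at h
  have hL : multiSchur μ a = (Matrix.of fun i j : Fin n => hMatrix a m (m + n)
      (betaPerm μ m n le_rfl hm (Fin.natAdd m i)) (Fin.natAdd m j)).det := by
    rw [multiSchur, jacobiTrudiDet]
    congr 1
    ext1 i j
    rw [Matrix.of_apply, Matrix.of_apply, hMatrix, Matrix.of_apply]
    change _ = hMulti (_ - ((betaFun μ m n le_rfl (Fin.natAdd m i) : ℕ) : ℤ)) _
    have h1 := μ.rowLen_anti 0 i (Nat.zero_le _)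
    rw [betaFun_natAdd, Fin.val_natAdd, Nat.cast_sub (by omega)]
    exact congrArg₂ hMulti (by push_cast; ring) (congrArg (tau · a) (by push_cast; ring))
  have hR : (Matrix.of fun i j : Fin m => eMatrix a m (m + n) (Fin.castAdd n i)
      (betaPerm μ m n le_rfl hm (Fin.castAdd n j))).det =
      (∏ j : Fin m, (-1) ^ μ.colLen j) * Matrix.det (Matrix.of fun i j : Fin m =>
      eDual ((μ.colLen i : ℤ) - (i : ℕ) + (j : ℕ)) (tau (j : ℕ) a)) := by
    -- Reversing both index orders and transposing gives the indexing of the target. Of the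
    -- checkerboard signs, the row and column factors (-1)^{m-1-i} and (-1)^{m-1-j} cancel in the
    -- determinant. What survives is (-1)^{|μ|}, which cancels the sign of the permutation.
    rw [← Matrix.det_submatrix_equiv_self Fin.revPerm, ← Matrix.det_transpose]
    have h2 : ∀ i j : Fin m, eMatrix a m (m + n) (Fin.castAdd n j.rev)
        (betaFun μ m n le_rfl (Fin.castAdd n i.rev)) = (-1) ^ (j.rev : ℕ) *
        ((-1) ^ (i.rev : ℕ) * ((-1) ^ μ.colLen i *
        eDual ((μ.colLen i : ℤ) - (i : ℕ) + (j : ℕ)) (tau (j : ℕ) a))) := by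
      intro i j
      rw [eMatrix, Matrix.of_apply, betaFun_castAdd, Fin.val_castAdd, Fin.rev_rev, pow_add,
        pow_add, mul_assoc, mul_assoc]
      have := Fin.val_rev i
      have := Fin.val_rev j
      congr 3
      exact congrArg₂ eDual (by omega) (congrArg (tau · a) (by omega))
    have h3 : (Matrix.of fun i j : Fin m => eMatrix a m (m + n) (Fin.castAdd n i)
        (betaPerm μ m n le_rfl hm (Fin.castAdd n j))).submatrix Fin.revPerm Fin.revPerm =
        Matrix.transpose (Matrix.of fun i j : Fin m => (-1) ^ (j.rev : ℕ) *
        Matrix.of (fun i j : Fin m => (-1) ^ (i.rev : ℕ) *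
        Matrix.of (fun i j : Fin m => (-1) ^ μ.colLen i *
        Matrix.of (fun i j : Fin m =>
          eDual ((μ.colLen i : ℤ) - (i : ℕ) + (j : ℕ)) (tau (j : ℕ) a)) i j) i j) i j) := by
      ext1 i j
      exact h2 j i
    rw [h3, Matrix.transpose_transpose, Matrix.det_mul_row, Matrix.det_mul_column,
      Matrix.det_mul_column, ← mul_assoc, ← Finset.prod_mul_distrib]
    simp [← pow_add, ← two_mul, pow_mul]
  rw [hL, h, hR, ← mul_assoc]
  push_cast
  rw [← Finset.prod_mul_distrib]
  simp [← pow_add, ← two_mul, pow_mul]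

/-! ### Duality, the e-functions and the Nägelsbach–Kostka formula -/

theorem rowLen_column_le_one_and_colLen_column (k : ℕ) :
    (column k).rowLen 0 ≤ 1 ∧ (column k).colLen 0 = k := by
  have h : ∀ i j, (i, j) ∈ column k ↔ i < k ∧ j = 0 := by
    intro i j
    simp [column, ← YoungDiagram.mem_cells, eq_comm]
  constructor
  · by_contra! h1
    have := (h 0 1).1 (YoungDiagram.mem_iff_lt_rowLen.2 h1)
    omega
  · refine le_antisymm ?_ ?_
    · by_contra! h1
      have := (h k 0).1 (YoungDiagram.mem_iff_lt_colLen.2 h1)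
      omega
    · by_contra! h1
      have := YoungDiagram.mem_iff_lt_colLen.1 ((h _ 0).2 ⟨h1, rfl⟩)
      omega

/-- For one column the dual Jacobi–Trudi determinant has order one. The order is still admissible
for k = 0, where the diagram is empty. -/
theorem eMulti_eq_eDual (k : ℤ) (a : ℤ → ℂ) : eMulti k a = eDual k a := by
  rw [eMulti]
  split_ifs with hk
  · obtain ⟨h1, h2⟩ := rowLen_column_le_one_and_colLen_column k.toNat
    rw [multiSchur_eq_det_eDual _ _ 1 h1, Matrix.det_fin_one, Matrix.of_apply]
    simp [h2, tau_zero, hk]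
  · rw [eDual_of_neg (by omega)]

theorem omega_multiSchur (μ : YoungDiagram) (a : ℤ → ℂ) :
    omega (multiSchur μ a) = multiSchur μ.transpose (dualSeq a) := by
  rw [multiSchur_eq_det_eDual μ.transpose _ (μ.colLen 0) (by rw [YoungDiagram.rowLen_transpose]),
    multiSchur, jacobiTrudiDet, AlgEquiv.map_det]
  congr 1
  ext1 i j
  change omega (hMulti _ _) = _
  rw [omega_hMulti, dualSeq_tau, neg_neg, Matrix.of_apply, YoungDiagram.colLen_transpose]

theorem factorialSeries_eMulti (a : ℤ → ℂ) :
    factorialSeries (dualSeq a) (fun k : ℕ => eMulti k a) = seriesE := by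
  simp only [eMulti_eq_eDual, eDual_natCast]
  exact factorialSeries_factorialCoeff _ _

theorem multiSchur_eq_det_eMulti (μ : YoungDiagram) (a : ℤ → ℂ) (n : ℕ)
    (hn : μ.transpose.colLen 0 ≤ n) : multiSchur μ a = Matrix.det (Matrix.of fun i j : Fin n =>
      eMulti ((μ.transpose.rowLen i : ℤ) - (i : ℕ) + (j : ℕ)) (tau (j : ℕ) a)) := by
  rw [YoungDiagram.colLen_transpose] at hn
  rw [multiSchur_eq_det_eDual μ a n hn]
  simp only [eMulti_eq_eDual, YoungDiagram.rowLen_transpose]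

/-! ## The Jacobi–Trudi formula for shifted Schur functions -/

/-- The component of `ψ` in `n` variables. -/
def psiAt (n : ℕ) : SymFun →ₐ[ℂ] MvPolynomial (Fin n) ℂ :=
  (Pi.evalAlgHom ℂ (fun n => MvPolynomial (Fin n) ℂ) n).comp (ShiftedSym.val.comp psi)

theorem psiAt_apply (n : ℕ) (F : SymFun) : psiAt n F = (psi F).1 n := rfl

/-- The sequence `a_i = i - 1/2`. -/
def halfSeq : ℤ → ℂ := fun i => (i : ℂ) - 1 / 2

/-- The zeros of (u - 1/2)^{↓k} are 1/2, 3/2, …, k - 1/2, so both sides are coefficients of the same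
expansion of H*(u - 1/2). -/
theorem psi_hMulti_halfSeq (k : ℕ) : psi (hMulti k halfSeq) = hStar k := by
  rw [hMulti_natCast, map_factorialCoeff, map_psi_seriesH, seriesHStar]
  have h : (fun i : ℤ => (1 / 2 : ℂ) + i - 1) = halfSeq := by
    funext i
    rw [halfSeq]
    ring
  rw [h, factorialCoeff_eq_of_factorialSeries_eq rfl]

/-- The cofactors of the first column in the determinant `det [(x_i + n - i)^{↓(n - j)}]`, where
`n = N + 1`. -/
def firstColCofactor (N : ℕ) (l : Fin (N + 1)) : MvPolynomial (Fin (N + 1)) ℂ :=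
  Matrix.adjugate (Matrix.of fun i j : Fin (N + 1) =>
    (descPochhammer (MvPolynomial (Fin (N + 1)) ℂ) (j.rev : ℕ)).eval (stairVar i)) 0 l

/-- The determinant `det [(x_i + n - i)^{↓(n - j)}]`, with `f(x_i + n - i)` in the first column,
for `n = N + 1`. -/
def firstColDet (N : ℕ) : Polynomial ℂ →ₗ[ℂ] MvPolynomial (Fin (N + 1)) ℂ :=
  ∑ l, LinearMap.mulLeft ℂ (firstColCofactor N l) ∘ₗ
    (Polynomial.aeval (stairVar l : MvPolynomial (Fin (N + 1)) ℂ)).toLinearMap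

theorem firstColDet_eq_sum (N : ℕ) (f : Polynomial ℂ) : firstColDet N f =
    ∑ l, firstColCofactor N l * Polynomial.aeval (stairVar l) f := by
  simp [firstColDet]

theorem firstColDet_eq_cramer (N : ℕ) (f : Polynomial ℂ) : firstColDet N f =
    Matrix.cramer (Matrix.of fun i j : Fin (N + 1) =>
      (descPochhammer (MvPolynomial (Fin (N + 1)) ℂ) (j.rev : ℕ)).eval (stairVar i))
      (fun i => Polynomial.aeval (stairVar i) f) 0 := by
  rw [Matrix.cramer_eq_adjugate_mulVec, firstColDet_eq_sum]
  rfl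

theorem aeval_descPochhammer {R : Type*} [CommRing R] [Algebra ℂ R] (y : R) (m : ℕ) :
    Polynomial.aeval y (descPochhammer ℂ m) = (descPochhammer R m).eval y := by
  rw [Polynomial.aeval_def, Polynomial.eval₂_eq_eval_map, descPochhammer_map]

theorem firstColDet_descPochhammer (N m : ℕ) : firstColDet N (descPochhammer ℂ m) =
    alternant (N + 1) fun j => if j = 0 then m else j.rev := by
  rw [firstColDet_eq_cramer, Matrix.cramer_apply, alternant]
  congr 1
  ext1 i j
  rw [Matrix.updateCol_apply, Matrix.of_apply, Matrix.of_apply]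
  split_ifs
  · exact aeval_descPochhammer _ _
  · rfl

/-- Column N - m, counted from zero, already contains the same falling powers. -/
theorem firstColDet_descPochhammer_of_lt {N m : ℕ} (h : m < N) :
    firstColDet N (descPochhammer ℂ m) = 0 := by
  rw [firstColDet_descPochhammer, alternant]
  have h0 : (⟨m, by omega⟩ : Fin (N + 1)).rev ≠ 0 := by
    intro h0
    have := congrArg Fin.val h0
    rw [Fin.val_rev, Fin.val_zero] at this
    simp only at this
    omega
  refine Matrix.det_zero_of_column_eq (i := 0) (j := (⟨m, by omega⟩ : Fin (N + 1)).rev) h0.symm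
    fun i => ?_
  rw [Matrix.of_apply, Matrix.of_apply, if_pos rfl, if_neg h0, Fin.rev_rev]

theorem firstColDet_descPochhammer_self (N : ℕ) :
    firstColDet N (descPochhammer ℂ N) = shiftedDen (N + 1) := by
  rw [firstColDet_descPochhammer, shiftedDen]
  congr 1
  funext j
  split_ifs with h
  · rw [h, Fin.rev_zero, Fin.val_last]
  · rfl

theorem shiftedDen_mul_hStar (N k : ℕ) : shiftedDen (N + 1) * (hStar k).1 (N + 1) =
    firstColDet N (descPochhammer ℂ (N + k)) := by
  obtain ⟨h1, h2⟩ := rowLen_column_le_one_and_colLen_column k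
  have h : (column k).transpose.colLen 0 ≤ N + 1 := by
    rw [YoungDiagram.colLen_transpose]
    omega
  have h3 := sstarPoly_mul (column k).transpose (N + 1) h
  rw [mul_comm, firstColDet_descPochhammer]
  refine h3.trans ?_
  rw [shiftedNum]
  congr 1
  funext j
  split_ifs with hj
  · rw [hj, Fin.val_zero, YoungDiagram.rowLen_transpose, h2, Fin.rev_zero, Fin.val_last, add_comm]
  · have hj' : (j : ℕ) ≠ 0 := fun h0 => hj (Fin.ext h0)
    rw [rowLen_eq_zero, zero_add]
    rw [YoungDiagram.colLen_transpose]
    omega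

/-- Each further shift of the sequence multiplies the first column by a linear factor that does not
depend on m. This separates the row index, which enters through m, from the column index j, and
makes the Jacobi–Trudi matrix factor. -/
theorem shiftedDen_mul_psiAt_hMulti (N m j : ℕ) :
    shiftedDen (N + 1) * psiAt (N + 1) (hMulti ((m : ℤ) - N + j) (tau (-(j : ℤ)) halfSeq)) =
    firstColDet N (descPochhammer ℂ m *
      ∏ r ∈ Finset.range j, (Polynomial.X - Polynomial.C ((N : ℂ) - r))) := by
  induction j generalizing m with
  | zero =>
    rw [Nat.cast_zero, neg_zero, tau_zero, add_zero, Finset.range_zero, Finset.prod_empty, mul_one]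
    by_cases h : m < N
    · rw [hMulti_of_neg (by omega), map_zero, mul_zero, firstColDet_descPochhammer_of_lt h]
    · obtain ⟨k, rfl⟩ := Nat.exists_eq_add_of_le (not_lt.1 h)
      rw [Nat.cast_add, add_sub_cancel_left, psiAt_apply, psi_hMulti_halfSeq,
        shiftedDen_mul_hStar]
  | succ j ih =>
    have h1 := ih (m + 1)
    have h2 := ih m
    have h3 : tau (-((j + 1 : ℕ) : ℤ)) halfSeq = tau (-1) (tau (-(j : ℤ)) halfSeq) := by
      rw [tau_tau]
      congr 1
      push_cast
      ring
    -- With this scalar, x^{↓(m+1)} + (m - N + j) x^{↓m} = x^{↓m} (x - (N - j)).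
    have h4 : tau (-(j : ℤ)) halfSeq ((m : ℤ) - N + (j + 1 : ℕ) - 1) -
        tau (-(j : ℤ)) halfSeq 0 = (m : ℂ) - N + j := by
      simp only [tau, halfSeq]
      push_cast
      ring
    rw [h3, hMulti_tau_neg_one, h4, map_add, map_smul, mul_add, mul_smul_comm]
    rw [show (m : ℤ) - N + (j + 1 : ℕ) - 1 = (m : ℤ) - N + j by push_cast; ring, h2,
      show (m : ℤ) - N + (j + 1 : ℕ) = ((m + 1 : ℕ) : ℤ) - N + j by push_cast; ring, h1,
      ← map_smul, ← map_add, Finset.prod_range_succ, descPochhammer_succ_right,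
      Polynomial.smul_eq_C_mul]
    congr 1
    simp only [map_sub, map_add, map_natCast]
    ring

/-- Expanding along the first column writes D times the (i, j) entry as a sum over l of (x_l + n -
l)^{↓(μ_i+n-i)} times a term that depends only on l and j. The matrix is thus a product whose second
factor does not involve μ. -/
theorem exists_shiftedDen_pow_mul_psiAt (N : ℕ) : ∃ K : MvPolynomial (Fin (N + 1)) ℂ,
    ∀ μ : YoungDiagram, shiftedDen (N + 1) ^ (N + 1) *
      psiAt (N + 1) (jacobiTrudiDet μ halfSeq (N + 1)) = shiftedNum μ (N + 1) * K := by
  refine ⟨Matrix.det (Matrix.of fun l j : Fin (N + 1) => firstColCofactor N l *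
    Polynomial.aeval (stairVar l)
      (∏ r ∈ Finset.range j, (Polynomial.X - Polynomial.C ((N : ℂ) - r)))), fun μ => ?_⟩
  rw [jacobiTrudiDet, AlgHom.map_det, shiftedNum, alternant, ← Matrix.det_transpose (Matrix.of _),
    ← Matrix.det_mul]
  have hs := Matrix.det_smul ((psiAt (N + 1)).mapMatrix (Matrix.of fun i j : Fin (N + 1) =>
    hMulti ((μ.rowLen i : ℤ) - (i : ℕ) + (j : ℕ)) (tau (-((j : ℕ) : ℤ)) halfSeq)))
    (shiftedDen (N + 1))
  rw [Fintype.card_fin] at hs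
  rw [← hs]
  congr 1
  ext1 i j
  have hi := Fin.val_rev i
  have h := shiftedDen_mul_psiAt_hMulti N (μ.rowLen i + i.rev) j
  rw [show ((μ.rowLen i + i.rev : ℕ) : ℤ) - N = μ.rowLen i - (i : ℕ) by push_cast; omega,
    firstColDet_eq_sum] at h
  refine h.trans ?_
  rw [Matrix.mul_apply]
  refine Finset.sum_congr rfl fun l _ => ?_
  rw [Matrix.transpose_apply, Matrix.of_apply, Matrix.of_apply, map_mul, aeval_descPochhammer]
  ring

theorem psiAt_multiSchur_halfSeq (μ : YoungDiagram) (N : ℕ) (hN : μ.colLen 0 ≤ N + 1) :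
    psiAt (N + 1) (multiSchur μ halfSeq) = sstarPoly μ (N + 1) := by
  obtain ⟨K, hK⟩ := exists_shiftedDen_pow_mul_psiAt N
  have hbot : (⊥ : YoungDiagram).colLen 0 = 0 := by
    by_contra h
    exact YoungDiagram.notMem_bot _
      (YoungDiagram.mem_iff_lt_colLen.2 (Nat.pos_of_ne_zero h))
  -- The empty diagram gives D^{N+1} = D · K. This identifies K without computing it.
  have h0 := hK ⊥
  have h1 := hK μ
  have hnum : shiftedNum ⊥ (N + 1) = shiftedDen (N + 1) := by
    rw [shiftedNum, shiftedDen]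
    congr 1
    funext j
    rw [rowLen_eq_zero (by omega), zero_add]
  have hone : multiSchur ⊥ halfSeq = 1 := by
    rw [← jacobiTrudiDet_eq ⊥ halfSeq 0 (by omega), jacobiTrudiDet, Matrix.det_fin_zero]
  rw [jacobiTrudiDet_eq _ _ _ (by omega), hnum, hone, map_one, mul_one] at h0
  rw [jacobiTrudiDet_eq _ _ _ hN, ← sstarPoly_mul μ _ hN, mul_assoc, ← h0, mul_comm] at h1
  exact mul_right_cancel₀ (pow_ne_zero _ (shiftedDen_ne_zero _)) h1

/-- Stability carries an equality in n + 1 variables down to n variables. -/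
theorem shiftedSym_ext (f g : ShiftedSym) (n₀ : ℕ) (h : ∀ n, n₀ ≤ n → f.1 n = g.1 n) :
    f = g := by
  have key : ∀ d n, n₀ ≤ n + d → f.1 n = g.1 n := by
    intro d
    induction d with
    | zero => exact fun n hn => h n hn
    | succ d ih =>
      intro n hn
      rw [← f.2.2.1 n, ← g.2.2.1 n, ih (n + 1) (by omega)]
  exact Subtype.ext (funext fun n => key n₀ n (by omega))

/-- The Jacobi–Trudi formula for shifted Schur functions. -/
theorem psi_multiSchur_halfSeq (μ : YoungDiagram) : psi (multiSchur μ halfSeq) = sstar μ := by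
  refine shiftedSym_ext _ _ (μ.colLen 0 + 1) fun n hn => ?_
  obtain ⟨N, rfl⟩ : ∃ N, n = N + 1 := ⟨n - 1, by omega⟩
  exact psiAt_multiSchur_halfSeq μ N (by omega)

/-! ## Injectivity of `ψ` -/

/-- A surjective endomorphism of a Noetherian ring is injective. -/
theorem injective_of_surjective_ringEnd {R : Type*} [CommRing R] [IsNoetherianRing R]
    (f : R →+* R) (hf : Function.Surjective f) : Function.Injective f := by
  have hiter : ∀ n x, (f ^ (n + 1)) x = (f ^ n) (f x) := fun n x => by
    rw [pow_succ, RingHom.mul_def, RingHom.comp_apply]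
  let K : ℕ →o Ideal R := ⟨fun n => RingHom.ker (f ^ n), monotone_nat_of_le_succ fun n x hx => by
    rw [RingHom.mem_ker] at hx ⊢
    rw [pow_succ', RingHom.mul_def, RingHom.comp_apply, hx, map_zero]⟩
  obtain ⟨n, hn⟩ := monotone_stabilizes_iff_noetherian.2 ‹IsNoetherianRing R› K
  have hs : Function.Surjective (f ^ n) := by
    rw [RingHom.coe_pow]
    exact hf.iterate n
  refine (injective_iff_map_eq_zero f).2 fun x hx => ?_
  -- The kernels of the powers stabilise at n. An element of ker f has the form fⁿ(y), so y lies in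
  -- ker fⁿ⁺¹ = ker fⁿ.
  obtain ⟨y, rfl⟩ := hs x
  have hy : y ∈ K (n + 1) := by
    change (f ^ (n + 1)) y = 0
    rw [pow_succ', RingHom.mul_def, RingHom.comp_apply, hx]
  rw [← hn (n + 1) (Nat.le_succ n)] at hy
  exact hy

/-- The falling powers are monic, one in each degree, so subtracting the leading term lowers the
degree. -/
theorem mem_of_degree_lt (W : Submodule ℂ (Polynomial ℂ)) (d : ℕ)
    (hW : ∀ m < d, descPochhammer ℂ m ∈ W) (f : Polynomial ℂ) (hf : f.degree < d) : f ∈ W := by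
  induction d generalizing f with
  | zero =>
    rw [Polynomial.degree_lt_iff_coeff_zero] at hf
    rw [Polynomial.ext (q := 0) fun n => (hf n (Nat.zero_le n)).trans
      (Polynomial.coeff_zero n).symm]
    exact W.zero_mem
  | succ d ih =>
    have h1 : f - f.coeff d • descPochhammer ℂ d ∈ W := by
      refine ih (fun m hm => hW m (by omega)) _ ?_
      rw [Polynomial.degree_lt_iff_coeff_zero] at hf ⊢
      intro m hm
      rw [Polynomial.coeff_sub, Polynomial.coeff_smul]
      rcases hm.eq_or_lt with rfl | hm
      · have h2 := (monic_descPochhammer ℂ d).coeff_natDegree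
        rw [descPochhammer_natDegree] at h2
        rw [h2, smul_eq_mul, mul_one, sub_self]
      · have h2 : (descPochhammer ℂ d).coeff m = 0 :=
          Polynomial.coeff_eq_zero_of_natDegree_lt (by rwa [descPochhammer_natDegree])
        rw [hf m hm, h2, smul_zero, sub_zero]
    simpa using W.add_mem h1 (W.smul_mem (f.coeff d) (hW d (Nat.lt_succ_self d)))

/-- The subalgebra `ℂ[p₁, …, p_n]` of `Λ`. -/
def psumSubalgebra (n : ℕ) : Subalgebra ℂ SymFun :=
  (MvPolynomial.rename (R := ℂ) (Fin.val : Fin n → ℕ)).range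

theorem psum_mem_psumSubalgebra {n k : ℕ} (h : k < n) : psum k ∈ psumSubalgebra n :=
  ⟨MvPolynomial.X ⟨k, h⟩, MvPolynomial.rename_X _ _⟩

theorem coeff_seriesH_mem {n k : ℕ} (h : k ≤ n) :
    PowerSeries.coeff k seriesH ∈ psumSubalgebra n := by
  induction k using Nat.strong_induction_on with
  | _ k ih =>
    cases k with
    | zero =>
      rw [PowerSeries.coeff_zero_eq_constantCoeff_apply, constantCoeff_seriesH]
      exact one_mem _
    | succ k =>
      have hk : (k + 1 : ℂ) ≠ 0 := by exact_mod_cast k.succ_ne_zero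
      have h1 : PowerSeries.coeff (k + 1) seriesH * (k + 1) ∈ psumSubalgebra n := by
        rw [newton_seriesH]
        refine sum_mem fun p hp => ?_
        have := Finset.HasAntidiagonal.mem_antidiagonal.1 hp
        exact mul_mem (ih _ (by omega) (by omega)) (psum_mem_psumSubalgebra (by omega))
      have h2 := (psumSubalgebra n).smul_mem h1 (k + 1 : ℂ)⁻¹
      have h3 : ((k : SymFun) + 1) = algebraMap ℂ SymFun (k + 1) := by simp
      rwa [h3, mul_comm, ← Algebra.smul_def, smul_smul, inv_mul_cancel₀ hk, one_smul] at h2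

theorem hMulti_mem_psumSubalgebra (a : ℤ → ℂ) {n k : ℕ} (h : k ≤ n) :
    hMulti k a ∈ psumSubalgebra n := by
  induction k using Nat.strong_induction_on with
  | _ k ih =>
    have h1 := congrArg (PowerSeries.coeff k) (factorialSeries_factorialCoeff a seriesH)
    rw [factorialSeries, PowerSeries.coeff_mk, Finset.sum_range_succ,
      coeff_invFactorialPower_self, one_smul, ← hMulti_natCast, ← eq_sub_iff_add_eq'] at h1
    rw [h1]
    refine sub_mem (coeff_seriesH_mem h) (sum_mem fun i hi => Subalgebra.smul_mem _ ?_ _)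
    have := Finset.mem_range.1 hi
    rw [← hMulti_natCast]
    exact ih i this (by omega)

/-! ### Surjectivity onto symmetric polynomials in finitely many shifted variables -/

theorem exists_firstColDet_eq_mul (N : ℕ) (f : Polynomial ℂ) (hf : f.degree < (2 * N + 2 : ℕ)) :
    ∃ r ∈ psumSubalgebra (N + 1), firstColDet N f = shiftedDen (N + 1) * psiAt (N + 1) r := by
  let W : Submodule ℂ (Polynomial ℂ) :=
    ((psumSubalgebra (N + 1)).toSubmodule.map
      (LinearMap.mulLeft ℂ (shiftedDen (N + 1)) ∘ₗ (psiAt (N + 1)).toLinearMap)).comap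
      (firstColDet N)
  have h : f ∈ W := by
    -- A falling power of degree N + k gives D · h*_k. The degree bound means k ≤ N + 1, so that
    -- `h_k` involves only p₁, …, p_{N+1}.
    refine mem_of_degree_lt W _ (fun m hm => ?_) f hf
    by_cases h : m < N
    · exact ⟨0, zero_mem _, by simp [firstColDet_descPochhammer_of_lt h]⟩
    · obtain ⟨k, rfl⟩ := Nat.exists_eq_add_of_le (not_lt.1 h)
      refine ⟨hMulti k halfSeq, hMulti_mem_psumSubalgebra _ (by omega), ?_⟩
      rw [← shiftedDen_mul_hStar, ← psi_hMulti_halfSeq]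
      rfl
  obtain ⟨r, hr, h⟩ := h
  exact ⟨r, hr, h.symm⟩

theorem firstColDet_of_degree_lt (N : ℕ) (f : Polynomial ℂ) (hf : f.degree < N) :
    firstColDet N f = 0 :=
  mem_of_degree_lt (LinearMap.ker (firstColDet N)) N
    (fun _ hm => firstColDet_descPochhammer_of_lt hm) f hf

theorem firstColDet_of_monic (N : ℕ) (f : Polynomial ℂ) (hf : f.Monic) (hd : f.degree = N) :
    firstColDet N f = shiftedDen (N + 1) := by
  have h1 := monic_descPochhammer ℂ N
  have h2 : firstColDet N (f - descPochhammer ℂ N) = 0 := by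
    refine firstColDet_of_degree_lt N _ ?_
    rw [← hd]
    refine Polynomial.degree_sub_lt_left ?_ hf.ne_zero (hf.leadingCoeff.trans h1.leadingCoeff.symm)
    rw [hd, Polynomial.degree_eq_natDegree h1.ne_zero, descPochhammer_natDegree]
  rw [map_sub, sub_eq_zero, firstColDet_descPochhammer_self] at h2
  exact h2

/-- The elementary symmetric polynomials in the variables `x_i - i`. -/
def shiftedEsymm (n j : ℕ) : MvPolynomial (Fin n) ℂ :=
  (Finset.univ.val.map fun i : Fin n => stairVar i - MvPolynomial.C (n : ℂ)).esymm j

theorem shiftHom_shiftedEsymm (n j : ℕ) :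
    shiftHom n (shiftedEsymm n j) = MvPolynomial.esymm (Fin n) ℂ j := by
  have h : (MvPolynomial.aeval fun i : Fin n => (stairVar i - MvPolynomial.C (n : ℂ) :
      MvPolynomial (Fin n) ℂ)) (MvPolynomial.esymm (Fin n) ℂ j) = shiftedEsymm n j :=
    MvPolynomial.aeval_esymm_eq_multiset_esymm _ _ _ _
  have h2 : (shiftHom n).comp (MvPolynomial.aeval fun i : Fin n =>
      (stairVar i - MvPolynomial.C (n : ℂ) : MvPolynomial (Fin n) ℂ)) = AlgHom.id ℂ _ := by
    refine MvPolynomial.algHom_ext fun i => ?_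
    rw [AlgHom.comp_apply, MvPolynomial.aeval_X, map_sub, shiftHom_stairVar,
      ← MvPolynomial.algebraMap_eq, AlgHom.commutes, add_sub_cancel_right, AlgHom.id_apply]
  rw [← h, ← AlgHom.comp_apply, h2, AlgHom.id_apply]

/-- Each y_l = x_l - l is a root of ∏(X - y_i). Multiplying this equation by y_l^k and by the
cofactor, and summing over l, gives the recursion for the elementary symmetric polynomials. -/
theorem sum_shiftedEsymm_mul_firstColDet (N k : ℕ) :
    ∑ j ∈ Finset.range (N + 2), (-1) ^ j * shiftedEsymm (N + 1) j *
      firstColDet N ((Polynomial.X - Polynomial.C ((N + 1 : ℕ) : ℂ)) ^ (N + 1 - j + k)) = 0 := by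
  simp only [firstColDet_eq_sum, Finset.mul_sum]
  rw [Finset.sum_comm]
  refine Finset.sum_eq_zero fun l _ => ?_
  have h := congrArg (Polynomial.eval (stairVar l - MvPolynomial.C ((N + 1 : ℕ) : ℂ)))
    (Multiset.prod_X_sub_X_eq_sum_esymm (Finset.univ.val.map fun i : Fin (N + 1) =>
      stairVar i - MvPolynomial.C ((N + 1 : ℕ) : ℂ)))
  rw [Polynomial.eval_multiset_prod, Multiset.map_map, Multiset.map_map, Multiset.prod_eq_zero
    (Multiset.mem_map.2 ⟨l, Finset.mem_univ_val l, by simp⟩), Polynomial.eval_finsetSum] at h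
  simp only [Multiset.card_map, Finset.card_val, Finset.card_univ, Fintype.card_fin,
    Polynomial.eval_mul, Polynomial.eval_pow, Polynomial.eval_neg, Polynomial.eval_one,
    Polynomial.eval_C, Polynomial.eval_X] at h
  have h2 := congrArg (fun x => firstColCofactor N l *
    (stairVar l - MvPolynomial.C ((N + 1 : ℕ) : ℂ)) ^ k * x) h
  simp only [mul_zero, Finset.mul_sum] at h2
  rw [h2]
  refine Finset.sum_congr rfl fun j _ => ?_
  simp only [map_pow, map_sub, Polynomial.aeval_X, Polynomial.aeval_C,
    MvPolynomial.algebraMap_eq, shiftedEsymm]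
  ring

theorem shiftedEsymm_mem (N j : ℕ) (hj : j ≤ N + 1) :
    shiftedEsymm (N + 1) j ∈ (psumSubalgebra (N + 1)).map (psiAt (N + 1)) := by
  induction j using Nat.strong_induction_on with
  | _ j ih =>
    cases j with
    | zero =>
      have h : shiftedEsymm (N + 1) 0 = 1 := by simp [shiftedEsymm, Multiset.esymm]
      rw [h]
      exact one_mem _
    | succ k =>
      set q : Polynomial ℂ := Polynomial.X - Polynomial.C ((N + 1 : ℕ) : ℂ) with hq
      have hqm : q.Monic := Polynomial.monic_X_sub_C _
      have hqd : ∀ m : ℕ, (q ^ m).degree = m := by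
        intro m
        rw [Polynomial.degree_pow, hq, Polynomial.degree_X_sub_C, nsmul_one]
      -- With this k the power in the summand j = k + 1 has degree N and contributes D times the
      -- elementary polynomial sought, up to sign. Larger j have degree below N and vanish. Smaller
      -- j have degree at most 2N + 1 and give D times an element of the image.
      have h := sum_shiftedEsymm_mul_firstColDet N k
      rw [← Finset.sum_subset (s₁ := Finset.range (k + 1 + 1)), Finset.sum_range_succ] at h
      · have hr : ∀ j ∈ Finset.range (k + 1), ∃ r ∈ psumSubalgebra (N + 1),
            firstColDet N (q ^ (N + 1 - j + k)) = shiftedDen (N + 1) * psiAt (N + 1) r := by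
          intro j _
          refine exists_firstColDet_eq_mul N _ ?_
          rw [hqd]
          exact_mod_cast (by omega)
        choose! r hrm hr using hr
        rw [show N + 1 - (k + 1) + k = N by omega, firstColDet_of_monic N (q ^ N) (hqm.pow N)
          (hqd N),
          Finset.sum_congr rfl fun j hj => by rw [hr j hj]] at h
        have h1 : shiftedEsymm (N + 1) (k + 1) = (-1) ^ k * ∑ j ∈ Finset.range (k + 1),
            (-1) ^ j * shiftedEsymm (N + 1) j * psiAt (N + 1) (r j) := by
          refine mul_right_cancel₀ (shiftedDen_ne_zero (N + 1)) ?_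
          rw [mul_assoc, Finset.sum_mul]
          have h2 : ∀ j, (-1) ^ j * shiftedEsymm (N + 1) j * psiAt (N + 1) (r j) *
              shiftedDen (N + 1) = (-1) ^ j * shiftedEsymm (N + 1) j *
              (shiftedDen (N + 1) * psiAt (N + 1) (r j)) := fun j => by ring
          simp only [h2]
          have h3 : ((-1) ^ k * (-1) ^ k : MvPolynomial (Fin (N + 1)) ℂ) = 1 := by
            rw [← mul_pow]; simp
          rw [pow_succ] at h
          linear_combination -(-1) ^ k * h -
            shiftedEsymm (N + 1) (k + 1) * shiftedDen (N + 1) * h3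
        rw [h1]
        have hneg : ∀ j : ℕ, ((-1) ^ j : MvPolynomial (Fin (N + 1)) ℂ) ∈
            (psumSubalgebra (N + 1)).map (psiAt (N + 1)) :=
          fun j => pow_mem (neg_mem (one_mem _)) j
        refine mul_mem (hneg k) (sum_mem fun j hj' => mul_mem (mul_mem (hneg j) ?_)
          ⟨r j, hrm j hj', rfl⟩)
        have := Finset.mem_range.1 hj'
        exact ih j this (by omega)
      · exact Finset.range_mono (by omega)
      · intro j hj1 hj2
        rw [Finset.mem_range] at hj1 hj2
        rw [firstColDet_of_degree_lt, mul_zero]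
        rw [hqd]
        exact_mod_cast (by omega)

/-- The restriction of `ψ` to `ℂ[p₁, …, p_n]`, with values in the symmetric polynomials in the
variables `x_i - i`. -/
def psiSymm (n : ℕ) : MvPolynomial (Fin n) ℂ →ₐ[ℂ] MvPolynomial.symmetricSubalgebra (Fin n) ℂ :=
  (((shiftHom n).comp (psiAt n)).codRestrict (MvPolynomial.symmetricSubalgebra (Fin n) ℂ)
    fun F => (psi F).2.1 n).comp (MvPolynomial.rename Fin.val)

theorem psiSymm_surjective (N : ℕ) : Function.Surjective (psiSymm (N + 1)) := by
  set e := MvPolynomial.esymmAlgEquiv (Fin (N + 1)) ℂ (Fintype.card_fin (N + 1)) with he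
  have h : (e.symm.toAlgHom.comp (psiSymm (N + 1))).range = ⊤ := by
    rw [eq_top_iff, ← MvPolynomial.adjoin_range_X, Algebra.adjoin_le_iff]
    rintro _ ⟨i, rfl⟩
    obtain ⟨_, ⟨F, rfl⟩, hF⟩ := shiftedEsymm_mem N (i + 1) (by omega)
    refine ⟨F, ?_⟩
    change e.symm (psiSymm (N + 1) F) = _
    rw [AlgEquiv.symm_apply_eq]
    apply Subtype.ext
    change shiftHom (N + 1) (psiAt (N + 1) _) = _
    refine (congrArg (shiftHom (N + 1)) hF).trans ?_
    rw [shiftHom_shiftedEsymm, he]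
    simp [MvPolynomial.esymmAlgEquiv, MvPolynomial.esymmAlgHom]
  intro s
  obtain ⟨F, hF⟩ := (AlgHom.range_eq_top _).1 h (e.symm s)
  exact ⟨F, e.symm.injective hF⟩

/-- The fundamental theorem on symmetric polynomials turns the map into a surjective endomorphism of
a polynomial ring in N + 1 variables, which is Noetherian. -/
theorem psiSymm_injective (N : ℕ) : Function.Injective (psiSymm (N + 1)) := by
  set e := MvPolynomial.esymmAlgEquiv (Fin (N + 1)) ℂ (Fintype.card_fin (N + 1))
  have h := injective_of_surjective_ringEnd
    (e.symm.toAlgHom.comp (psiSymm (N + 1))).toRingHom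
    (e.symm.surjective.comp (psiSymm_surjective N))
  exact Function.Injective.of_comp (f := e.symm) h

theorem psi_injective : Function.Injective psi := by
  refine (injective_iff_map_eq_zero psi).2 fun F hF => ?_
  -- An element of the kernel involves finitely many power sums, so the component in sufficiently
  -- many variables detects it.
  obtain ⟨N, hN⟩ : ∃ N, ∀ i ∈ F.vars, i < N + 1 :=
    ⟨F.vars.sup id, fun i hi => Nat.lt_succ_of_le (Finset.le_sup (f := id) hi)⟩
  obtain ⟨G, rfl⟩ := MvPolynomial.exists_rename_eq_of_vars_subset_range F
    (Fin.val : Fin (N + 1) → ℕ) Fin.val_injective fun i hi => ⟨⟨i, hN i hi⟩, rfl⟩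
  have h : psiSymm (N + 1) G = 0 := by
    apply Subtype.ext
    change shiftHom (N + 1) ((psi (MvPolynomial.rename Fin.val G)).1 (N + 1)) = 0
    rw [hF]
    exact map_zero _
  rw [psiSymm_injective N (h.trans (map_zero _).symm), map_zero]

theorem psi_eq_sstar_iff (μ : YoungDiagram) (F : SymFun) :
    psi F = sstar μ ↔ F = frobeniusSchur μ := by
  -- The Jacobi–Trudi formula provides a preimage, so `Function.invFun` does not fall back on its
  -- default value here.
  have h : psi (frobeniusSchur μ) = sstar μ :=
    Function.invFun_eq ⟨_, psi_multiSchur_halfSeq μ⟩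
  refine ⟨fun hF => psi_injective (hF.trans h.symm), ?_⟩
  rintro rfl
  exact h

theorem multiSchur_halfSeq (μ : YoungDiagram) :
    multiSchur μ (fun i => (i : ℂ) - 1 / 2) = frobeniusSchur μ :=
  (psi_eq_sstar_iff μ _).1 (psi_multiSchur_halfSeq μ)

theorem omega_frobeniusSchur (μ : YoungDiagram) :
    omega (frobeniusSchur μ) = frobeniusSchur μ.transpose := by
  rw [← multiSchur_halfSeq, ← multiSchur_halfSeq, omega_multiSchur]
  congr 1
  funext i
  rw [dualSeq]
  push_cast
  ring

end

end FrobeniusSchur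

theorem corollary4p7 :
    -- duality
    (∀ (μ : YoungDiagram) (a : ℤ → ℂ),
      FrobeniusSchur.omega (FrobeniusSchur.multiSchur μ a) =
        FrobeniusSchur.multiSchur μ.transpose (FrobeniusSchur.dualSeq a)) ∧
    -- `Fs_μ = φ(s*_μ)` is the one element that `ψ = φ⁻¹` sends to `s*_μ`
    (∀ (μ : YoungDiagram) (F : FrobeniusSchur.SymFun),
      FrobeniusSchur.psi F = FrobeniusSchur.sstar μ ↔ F = FrobeniusSchur.frobeniusSchur μ) ∧
    -- the Frobenius–Schur functions are the case `a_i = i - 1/2`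
    (∀ μ : YoungDiagram,
      FrobeniusSchur.multiSchur μ (fun i => (i : ℂ) - 1 / 2) =
        FrobeniusSchur.frobeniusSchur μ) ∧
    -- duality for the Frobenius–Schur functions
    (∀ μ : YoungDiagram,
      FrobeniusSchur.omega (FrobeniusSchur.frobeniusSchur μ) =
        FrobeniusSchur.frobeniusSchur μ.transpose) ∧
    -- generating series of the `e_{k;a}`
    (∀ a : ℤ → ℂ,
      FrobeniusSchur.factorialSeries (FrobeniusSchur.dualSeq a)
        (fun k : ℕ => FrobeniusSchur.eMulti k a) = FrobeniusSchur.seriesE) ∧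
    -- the Nägelsbach–Kostka formula, with a determinant of any order `n ≥ ℓ(μ')`
    (∀ (μ : YoungDiagram) (a : ℤ → ℂ) (n : ℕ), μ.transpose.colLen 0 ≤ n →
      FrobeniusSchur.multiSchur μ a = Matrix.det (Matrix.of fun i j : Fin n =>
        FrobeniusSchur.eMulti ((μ.transpose.rowLen i : ℤ) - (i : ℕ) + (j : ℕ))
          (FrobeniusSchur.tau (j : ℕ) a))) := by
  open FrobeniusSchur in
  exact ⟨omega_multiSchur, psi_eq_sstar_iff, multiSchur_halfSeq, omega_frobeniusSchur,
    factorialSeries_eMulti, multiSchur_eq_det_eMulti⟩
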